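/- A PROP is a strict symmetric monoidal category with object monoid $(\mathbb N,+,0)$, and a morphism of PROPs is an identity-on-objects strict symmetric monoidal functor. Write $\underline n=\{1,\dots,n\}$. Let $\mathbf{Cospan}(\mathbf{FinSet})$ be the (skeletal) PROP whose morphisms $m\to n$ are isomorphism classes of cospans of finite sets $\underline m\xrightarrow{a}N\xleftarrow{b}\underline n$, composed by pushout, with tensor product given by disjoint union and symmetries given by the block transpositions. Let $\mathbf{FinCorel}$ be the PROP whose morphisms $m\to n$ are equivalence relations on $\underline m\sqcup\underline n$; the composite of $R:m\to n$ and $S:n\to p$ is the restriction to $\underline m\sqcup\underline p$ of the transitive closure of $R\cup S$ on $\underline m\sqcup\underline n\sqcup\underline p$, the tensor product is disjoint union (with reindexing), and the symmetries identify each input with its image under the block transposition. Let $\mathbf{ESCFM}$ be the PROP for extraspecial commutative Frobenius monoids, i.e. the PROP presented by generators $\mu:2\to1$, $\eta:0\to1$, $\delta:1\to2$, $\epsilon:1\to0$ subject to the equations saying that $(\mu,\eta)$ is a commutative monoid and $(\delta,\epsilon)$ a cocommutative comonoid, the Frobenius law $(\mathrm{id}_1+\mu)\circ(\delta+\mathrm{id}_1)=\delta\circ\mu=(\mu+\mathrm{id}_1)\circ(\mathrm{id}_1+\delta)$,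 the special law $\mu\circ\delta=\mathrm{id}_1$ and the extra law $\epsilon\circ\eta=\mathrm{id}_0$. Theorem. The assignment that is the identity on objects and sends the class of a cospan $\underline m\xrightarrow{a}N\xleftarrow{b}\underline n$ to the kernel of its joint map $[a,b]:\underline m\sqcup\underline n\to N$ (that is, $x\sim y$ iff $[a,b](x)=[a,b](y)$) is a well-defined strict symmetric monoidal functor $\bar\Pi:\mathbf{Cospan}(\mathbf{FinSet})\to\mathbf{FinCorel}$. The functor that it induces on the quotient of $\mathbf{Cospan}(\mathbf{FinSet})$ by the kernel congruence $\ker\bar\Pi=\{(f,g)\mid\bar\Pi(f)=\bar\Pi(g)\}$ is an isomorphism of PROPs $$\mathbf{Cospan}(\mathbf{FinSet})/\ker(\bar\Pi)\ \xrightarrow{\ \cong\ }\ \mathbf{FinCorel}.$$ Moreover, $\mathbf{FinCorel}$ is isomorphic, as a PROP, to $\mathbf{ESCFM}$. -/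

import Mathlib

universe u v

/-- The operations of a strict symmetric monoidal category whose monoid of objects is
`(ℕ, +, 0)`. Composition is written in diagrammatic order: `comp f g` is `f` followed by `g`. -/
structure PROPData where
  Hom : ℕ → ℕ → Type u
  id : ∀ n : ℕ, Hom n n
  comp : ∀ {a b c : ℕ}, Hom a b → Hom b c → Hom a c
  tensor : ∀ {a b c d : ℕ}, Hom a b → Hom c d → Hom (a + c) (b + d)
  swap : ∀ m n : ℕ, Hom (m + n) (n + m)

/-- The identity morphism of an object, seen as a morphism between two equal natural numbers.
It serves to write down the strictness laws (associators and unitors are identities), since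
for instance `(a + b) + c` and `a + (b + c)` are equal but not definitionally equal. -/
def PROPData.eqHom (P : PROPData.{u}) {a b : ℕ} (h : a = b) : P.Hom a b :=
  h ▸ P.id a

/-- A PROP: a strict symmetric monoidal category with object monoid `(ℕ, +, 0)`. -/
structure PROP extends PROPData.{u} where
  id_comp : ∀ {a b : ℕ} (f : Hom a b), comp (id a) f = f
  comp_id : ∀ {a b : ℕ} (f : Hom a b), comp f (id b) = f
  assoc : ∀ {a b c d : ℕ} (f : Hom a b) (g : Hom b c) (h : Hom c d),
    comp (comp f g) h = comp f (comp g h)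
  tensor_id : ∀ m n : ℕ, tensor (id m) (id n) = id (m + n)
  interchange : ∀ {a b c a' b' c' : ℕ} (f : Hom a b) (g : Hom b c) (f' : Hom a' b')
    (g' : Hom b' c'), tensor (comp f g) (comp f' g') = comp (tensor f f') (tensor g g')
  tensor_assoc : ∀ {a a' b b' c c' : ℕ} (f : Hom a a') (g : Hom b b') (h : Hom c c'),
    comp (tensor (tensor f g) h) (toPROPData.eqHom (Nat.add_assoc a' b' c')) =
      comp (toPROPData.eqHom (Nat.add_assoc a b c)) (tensor f (tensor g h))
  unit_tensor : ∀ {a b : ℕ} (f : Hom a b),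
    comp (tensor (id 0) f) (toPROPData.eqHom (Nat.zero_add b)) =
      comp (toPROPData.eqHom (Nat.zero_add a)) f
  tensor_unit : ∀ {a b : ℕ} (f : Hom a b),
    comp (tensor f (id 0)) (toPROPData.eqHom (Nat.add_zero b)) =
      comp (toPROPData.eqHom (Nat.add_zero a)) f
  swap_natural : ∀ {a a' b b' : ℕ} (f : Hom a a') (g : Hom b b'),
    comp (tensor f g) (swap a' b') = comp (swap a b) (tensor g f)
  swap_swap : ∀ m n : ℕ, comp (swap m n) (swap n m) = id (m + n)
  hexagon : ∀ m n p : ℕ,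
    comp (tensor (swap m n) (id p))
        (comp (toPROPData.eqHom (Nat.add_assoc n m p)) (tensor (id n) (swap m p))) =
      comp (toPROPData.eqHom (Nat.add_assoc m n p))
        (comp (swap m (n + p)) (toPROPData.eqHom (Nat.add_assoc n p m)))

namespace PROP

/-- A morphism of PROPs: an identity-on-objects strict symmetric monoidal functor. -/
structure Morphism (P : PROP.{u}) (Q : PROP.{v}) where
  map : ∀ {a b : ℕ}, P.Hom a b → Q.Hom a b
  map_id : ∀ n : ℕ, map (P.id n) = Q.id n
  map_comp : ∀ {a b c : ℕ} (f : P.Hom a b) (g : P.Hom b c),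
    map (P.comp f g) = Q.comp (map f) (map g)
  map_tensor : ∀ {a b c d : ℕ} (f : P.Hom a b) (g : P.Hom c d),
    map (P.tensor f g) = Q.tensor (map f) (map g)
  map_swap : ∀ m n : ℕ, map (P.swap m n) = Q.swap m n

/-- An isomorphism of PROPs: a pair of mutually inverse morphisms of PROPs. -/
structure Iso (P : PROP.{u}) (Q : PROP.{v}) where
  hom : Morphism P Q
  inv : Morphism Q P
  hom_inv : ∀ {a b : ℕ} (f : P.Hom a b), inv.map (hom.map f) = f
  inv_hom : ∀ {a b : ℕ} (g : Q.Hom a b), hom.map (inv.map g) = g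

/-- A PROP congruence: an equivalence relation on every hom-set, stable under composition
and tensor. -/
structure Congruence (P : PROP.{u}) where
  r : ∀ a b : ℕ, Setoid (P.Hom a b)
  comp : ∀ {a b c : ℕ} {f f' : P.Hom a b} {g g' : P.Hom b c},
    r a b f f' → r b c g g' → r a c (P.comp f g) (P.comp f' g')
  tensor : ∀ {a b c d : ℕ} {f f' : P.Hom a b} {g g' : P.Hom c d},
    r a b f f' → r c d g g' → r (a + c) (b + d) (P.tensor f g) (P.tensor f' g')

/-- The operations of the quotient of a PROP by a congruence. -/
def quotientData (P : PROP.{u}) (c : P.Congruence) : PROPData.{u} where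
  Hom a b := Quotient (c.r a b)
  id n := Quotient.mk _ (P.id n)
  comp := Quotient.map₂ P.comp fun _ _ h _ _ h' => c.comp h h'
  tensor := Quotient.map₂ P.tensor fun _ _ h _ _ h' => c.tensor h h'
  swap m n := Quotient.mk _ (P.swap m n)

theorem quotientData_eqHom (P : PROP.{u}) (c : P.Congruence) {a b : ℕ} (h : a = b) :
    (P.quotientData c).eqHom h = Quotient.mk (c.r a b) (P.eqHom h) := by
  subst h; rfl

/-- The quotient of a PROP by a congruence. -/
def quotient (P : PROP.{u}) (c : P.Congruence) : PROP.{u} where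
  toPROPData := P.quotientData c
  id_comp := by rintro a b ⟨f⟩; exact congrArg (Quotient.mk _) (P.id_comp f)
  comp_id := by rintro a b ⟨f⟩; exact congrArg (Quotient.mk _) (P.comp_id f)
  assoc := by rintro a b c d ⟨f⟩ ⟨g⟩ ⟨h⟩; exact congrArg (Quotient.mk _) (P.assoc f g h)
  tensor_id m n := congrArg (Quotient.mk _) (P.tensor_id m n)
  interchange := by
    rintro a b c a' b' c' ⟨f⟩ ⟨g⟩ ⟨f'⟩ ⟨g'⟩
    exact congrArg (Quotient.mk _) (P.interchange f g f' g')
  tensor_assoc := by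
    rintro a a' b b' c c' ⟨f⟩ ⟨g⟩ ⟨h⟩
    simp only [quotientData_eqHom]
    exact congrArg (Quotient.mk _) (P.tensor_assoc f g h)
  unit_tensor := by
    rintro a b ⟨f⟩
    simp only [quotientData_eqHom]
    exact congrArg (Quotient.mk _) (P.unit_tensor f)
  tensor_unit := by
    rintro a b ⟨f⟩
    simp only [quotientData_eqHom]
    exact congrArg (Quotient.mk _) (P.tensor_unit f)
  swap_natural := by
    rintro a a' b b' ⟨f⟩ ⟨g⟩
    exact congrArg (Quotient.mk _) (P.swap_natural f g)
  swap_swap m n := congrArg (Quotient.mk _) (P.swap_swap m n)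
  hexagon m n p := by
    simp only [quotientData_eqHom]
    exact congrArg (Quotient.mk _) (P.hexagon m n p)

/-- The projection of a PROP onto its quotient by a congruence. -/
def proj (P : PROP.{u}) (c : P.Congruence) : Morphism P (P.quotient c) where
  map f := Quotient.mk _ f
  map_id _ := rfl
  map_comp _ _ := rfl
  map_tensor _ _ := rfl
  map_swap _ _ := rfl

/-- The kernel congruence of a morphism of PROPs: `f ≡ g` iff `F f = F g`. -/
def Morphism.ker {P : PROP.{u}} {Q : PROP.{v}} (F : Morphism P Q) : P.Congruence where
  r a b := Setoid.ker (F.map (a := a) (b := b))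
  comp {a b c f f' g g'} h h' := by
    change F.map _ = F.map _
    rw [F.map_comp, F.map_comp, show F.map f = F.map f' from h, show F.map g = F.map g' from h']
  tensor {a b c d f f' g g'} h h' := by
    change F.map _ = F.map _
    rw [F.map_tensor, F.map_tensor, show F.map f = F.map f' from h,
      show F.map g = F.map g' from h']

/-- Formal terms over a signature `G`, where `G a b` is the set of generators `a → b`. -/
inductive Term (G : ℕ → ℕ → Type) : ℕ → ℕ → Type
  | gen {a b : ℕ} (g : G a b) : Term G a b
  | id (n : ℕ) : Term G n n
  | comp {a b c : ℕ} (f : Term G a b) (g : Term G b c) : Term G a c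
  | tensor {a b c d : ℕ} (f : Term G a b) (g : Term G c d) : Term G (a + c) (b + d)
  | swap (m n : ℕ) : Term G (m + n) (n + m)

/-- The formal operations on terms (the PROP laws do not hold yet). -/
def termData (G : ℕ → ℕ → Type) : PROPData.{0} where
  Hom := Term G
  id := Term.id
  comp := Term.comp
  tensor := Term.tensor
  swap := Term.swap

/-- The smallest family of equivalence relations on terms that contains the equations `E` and
the PROP laws and is stable under composition and tensor. -/
inductive TermRel {G : ℕ → ℕ → Type} (E : ∀ a b : ℕ, Term G a b → Term G a b → Prop) :
    ∀ a b : ℕ, Term G a b → Term G a b → Prop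
  | of {a b : ℕ} {s t : Term G a b} (h : E a b s t) : TermRel E a b s t
  | refl {a b : ℕ} (s : Term G a b) : TermRel E a b s s
  | symm {a b : ℕ} {s t : Term G a b} (h : TermRel E a b s t) : TermRel E a b t s
  | trans {a b : ℕ} {s t w : Term G a b} (h : TermRel E a b s t) (h' : TermRel E a b t w) :
      TermRel E a b s w
  | comp {a b c : ℕ} {s s' : Term G a b} {t t' : Term G b c} (h : TermRel E a b s s')
      (h' : TermRel E b c t t') : TermRel E a c (.comp s t) (.comp s' t')
  | tensor {a b c d : ℕ} {s s' : Term G a b} {t t' : Term G c d} (h : TermRel E a b s s')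
      (h' : TermRel E c d t t') : TermRel E (a + c) (b + d) (.tensor s t) (.tensor s' t')
  | id_comp {a b : ℕ} (f : Term G a b) : TermRel E a b (.comp (.id a) f) f
  | comp_id {a b : ℕ} (f : Term G a b) : TermRel E a b (.comp f (.id b)) f
  | assoc {a b c d : ℕ} (f : Term G a b) (g : Term G b c) (h : Term G c d) :
      TermRel E a d (.comp (.comp f g) h) (.comp f (.comp g h))
  | tensor_id (m n : ℕ) :
      TermRel E (m + n) (m + n) (.tensor (.id m) (.id n)) (.id (m + n))
  | interchange {a b c a' b' c' : ℕ} (f : Term G a b) (g : Term G b c) (f' : Term G a' b')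
      (g' : Term G b' c') : TermRel E (a + a') (c + c')
        (.tensor (.comp f g) (.comp f' g')) (.comp (.tensor f f') (.tensor g g'))
  | tensor_assoc {a a' b b' c c' : ℕ} (f : Term G a a') (g : Term G b b') (h : Term G c c') :
      TermRel E (a + b + c) (a' + (b' + c'))
        (.comp (.tensor (.tensor f g) h) ((termData G).eqHom (Nat.add_assoc a' b' c')))
        (.comp ((termData G).eqHom (Nat.add_assoc a b c)) (.tensor f (.tensor g h)))
  | unit_tensor {a b : ℕ} (f : Term G a b) : TermRel E (0 + a) b
      (.comp (.tensor (.id 0) f) ((termData G).eqHom (Nat.zero_add b)))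
      (.comp ((termData G).eqHom (Nat.zero_add a)) f)
  | tensor_unit {a b : ℕ} (f : Term G a b) : TermRel E (a + 0) b
      (.comp (.tensor f (.id 0)) ((termData G).eqHom (Nat.add_zero b)))
      (.comp ((termData G).eqHom (Nat.add_zero a)) f)
  | swap_natural {a a' b b' : ℕ} (f : Term G a a') (g : Term G b b') :
      TermRel E (a + b) (b' + a')
        (.comp (.tensor f g) (.swap a' b')) (.comp (.swap a b) (.tensor g f))
  | swap_swap (m n : ℕ) :
      TermRel E (m + n) (m + n) (.comp (.swap m n) (.swap n m)) (.id (m + n))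
  | hexagon (m n p : ℕ) : TermRel E (m + n + p) (n + (p + m))
      (.comp (.tensor (.swap m n) (.id p))
        (.comp ((termData G).eqHom (Nat.add_assoc n m p)) (.tensor (.id n) (.swap m p))))
      (.comp ((termData G).eqHom (Nat.add_assoc m n p))
        (.comp (.swap m (n + p)) ((termData G).eqHom (Nat.add_assoc n p m))))

/-- `TermRel E` as an equivalence relation on every hom-set. -/
def termSetoid {G : ℕ → ℕ → Type} (E : ∀ a b : ℕ, Term G a b → Term G a b → Prop) (a b : ℕ) :
    Setoid (Term G a b) :=
  ⟨TermRel E a b, .refl, .symm, .trans⟩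

/-- The operations of the PROP presented by generators `G` and equations `E`. -/
def presentedData {G : ℕ → ℕ → Type} (E : ∀ a b : ℕ, Term G a b → Term G a b → Prop) :
    PROPData.{0} where
  Hom a b := Quotient (termSetoid E a b)
  id n := Quotient.mk _ (.id n)
  comp := Quotient.map₂ .comp fun _ _ h _ _ h' => .comp h h'
  tensor := Quotient.map₂ .tensor fun _ _ h _ _ h' => .tensor h h'
  swap m n := Quotient.mk _ (.swap m n)

theorem presentedData_eqHom {G : ℕ → ℕ → Type}
    (E : ∀ a b : ℕ, Term G a b → Term G a b → Prop) {a b : ℕ} (h : a = b) :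
    (presentedData E).eqHom h = Quotient.mk (termSetoid E a b) ((termData G).eqHom h) := by
  subst h; rfl

/-- The PROP presented by generators `G` and equations `E`. -/
def presented {G : ℕ → ℕ → Type} (E : ∀ a b : ℕ, Term G a b → Term G a b → Prop) :
    PROP.{0} where
  toPROPData := presentedData E
  id_comp := by rintro a b ⟨f⟩; exact Quotient.sound (TermRel.id_comp f)
  comp_id := by rintro a b ⟨f⟩; exact Quotient.sound (TermRel.comp_id f)
  assoc := by rintro a b c d ⟨f⟩ ⟨g⟩ ⟨h⟩; exact Quotient.sound (TermRel.assoc f g h)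
  tensor_id m n := Quotient.sound (TermRel.tensor_id m n)
  interchange := by
    rintro a b c a' b' c' ⟨f⟩ ⟨g⟩ ⟨f'⟩ ⟨g'⟩
    exact Quotient.sound (TermRel.interchange f g f' g')
  tensor_assoc := by
    rintro a a' b b' c c' ⟨f⟩ ⟨g⟩ ⟨h⟩
    simp only [presentedData_eqHom]
    exact Quotient.sound (TermRel.tensor_assoc f g h)
  unit_tensor := by
    rintro a b ⟨f⟩
    simp only [presentedData_eqHom]
    exact Quotient.sound (TermRel.unit_tensor f)
  tensor_unit := by
    rintro a b ⟨f⟩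
    simp only [presentedData_eqHom]
    exact Quotient.sound (TermRel.tensor_unit f)
  swap_natural := by
    rintro a a' b b' ⟨f⟩ ⟨g⟩
    exact Quotient.sound (TermRel.swap_natural f g)
  swap_swap m n := Quotient.sound (TermRel.swap_swap m n)
  hexagon m n p := by
    simp only [presentedData_eqHom]
    exact Quotient.sound (TermRel.hexagon m n p)

end PROP

/-- The generators of the theory of Frobenius monoids. -/
inductive FrobGen : ℕ → ℕ → Type
  | mul : FrobGen 2 1
  | unit : FrobGen 0 1
  | comul : FrobGen 1 2
  | counit : FrobGen 1 0

namespace FrobGen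

/-- Multiplication as a term. -/
abbrev μ : PROP.Term FrobGen 2 1 := .gen .mul
/-- Unit as a term. -/
abbrev η : PROP.Term FrobGen 0 1 := .gen .unit
/-- Comultiplication as a term. -/
abbrev δ : PROP.Term FrobGen 1 2 := .gen .comul
/-- Counit as a term. -/
abbrev ε : PROP.Term FrobGen 1 0 := .gen .counit
/-- The identity of the object `1` as a term. -/
abbrev I : PROP.Term FrobGen 1 1 := .id 1

end FrobGen

open FrobGen PROP.Term in
/-- The equations of extraspecial commutative Frobenius monoids: a commutative monoid and a
cocommutative comonoid satisfying the Frobenius law, the special law and the extra law. -/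
inductive ESCFMEq : ∀ a b : ℕ, PROP.Term FrobGen a b → PROP.Term FrobGen a b → Prop
  | mul_assoc : ESCFMEq 3 1 (comp (tensor μ I) μ) (comp (tensor I μ) μ)
  | unit_mul : ESCFMEq 1 1 (comp (tensor η I) μ) I
  | mul_unit : ESCFMEq 1 1 (comp (tensor I η) μ) I
  | mul_comm : ESCFMEq 2 1 (comp (swap 1 1) μ) μ
  | comul_coassoc : ESCFMEq 1 3 (comp δ (tensor δ I)) (comp δ (tensor I δ))
  | counit_comul : ESCFMEq 1 1 (comp δ (tensor ε I)) I
  | comul_counit : ESCFMEq 1 1 (comp δ (tensor I ε)) I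
  | comul_comm : ESCFMEq 1 2 (comp δ (swap 1 1)) δ
  | frobenius_left : ESCFMEq 2 2 (comp (tensor δ I) (tensor I μ)) (comp μ δ)
  | frobenius_right : ESCFMEq 2 2 (comp (tensor I δ) (tensor μ I)) (comp μ δ)
  | special : ESCFMEq 1 1 (comp δ μ) I
  | extra : ESCFMEq 0 0 (comp η ε) (id 0)

/-- The PROP for extraspecial commutative Frobenius monoids. -/
def ESCFM : PROP.{0} := PROP.presented ESCFMEq

/-- A cospan `{1, …, m} → N ← {1, …, n}` of finite sets. -/
structure FinCospan (m n : ℕ) where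
  apex : Type
  finite_apex : Finite apex
  left : Fin m → apex
  right : Fin n → apex

namespace FinCospan

/-- The joint map `{1, …, m} ⊔ {1, …, n} → N` of a cospan. -/
def joint {m n : ℕ} (c : FinCospan m n) : Fin m ⊕ Fin n → c.apex := Sum.elim c.left c.right

/-- Two cospans are isomorphic if a bijection of the apexes commutes with the legs. -/
def Iso {m n : ℕ} (c d : FinCospan m n) : Prop :=
  ∃ e : c.apex ≃ d.apex, (∀ x, e (c.left x) = d.left x) ∧ ∀ y, e (c.right y) = d.right y

/-- The cospan `X → Y = Y` of a map of finite sets. -/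
def ofFun {m n : ℕ} (f : Fin m → Fin n) : FinCospan m n := ⟨Fin n, inferInstance, f, _root_.id⟩

/-- The pushout of the span `N ← Y → N'` formed by the inner legs of two composable cospans. -/
def Pushout {a b c : ℕ} (f : FinCospan a b) (g : FinCospan b c) : Type :=
  Quot fun u v : f.apex ⊕ g.apex => ∃ y : Fin b, u = .inl (f.right y) ∧ v = .inr (g.left y)

theorem finite_pushout {a b c : ℕ} (f : FinCospan a b) (g : FinCospan b c) :
    Finite (Pushout f g) := by
  have := f.finite_apex
  have := g.finite_apex
  exact Quot.finite _

theorem glue {a b c : ℕ} (f : FinCospan a b) (g : FinCospan b c) (y : Fin b) :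
    (Quot.mk _ (.inl (f.right y)) : Pushout f g) = Quot.mk _ (.inr (g.left y)) :=
  Quot.sound ⟨y, rfl, rfl⟩

/-- The universal property of the pushout. -/
theorem existsUnique_desc {a b c : ℕ} (f : FinCospan a b) (g : FinCospan b c) (T : Type)
    (s : f.apex → T) (t : g.apex → T) (h : ∀ y, s (f.right y) = t (g.left y)) :
    ∃! d : Pushout f g → T,
      (∀ x, d (Quot.mk _ (.inl x)) = s x) ∧ ∀ x, d (Quot.mk _ (.inr x)) = t x := by
  refine ⟨Quot.lift (Sum.elim s t) ?_, ⟨fun _ => rfl, fun _ => rfl⟩, ?_⟩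
  · rintro _ _ ⟨y, rfl, rfl⟩
    exact h y
  · rintro d ⟨hs, ht⟩
    funext u
    obtain ⟨u | u⟩ := u
    · exact hs u
    · exact ht u

/-- Identities, composition by pushout, tensor by disjoint union, and the block transpositions,
on the level of cospans. -/
def data : PROPData.{1} where
  Hom := FinCospan
  id _ := ofFun _root_.id
  comp f g := ⟨Pushout f g, finite_pushout f g, fun x => Quot.mk _ (.inl (f.left x)),
    fun z => Quot.mk _ (.inr (g.right z))⟩
  tensor f g := ⟨f.apex ⊕ g.apex,
    have := f.finite_apex; have := g.finite_apex; inferInstance,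
    Sum.map f.left g.left ∘ finSumFinEquiv.symm, Sum.map f.right g.right ∘ finSumFinEquiv.symm⟩
  swap _ _ := ofFun finAddFlip

theorem Iso.refl {m n : ℕ} (c : FinCospan m n) : Iso c c :=
  ⟨Equiv.refl _, fun _ => rfl, fun _ => rfl⟩

theorem Iso.symm {m n : ℕ} {c d : FinCospan m n} : Iso c d → Iso d c := by
  rintro ⟨e, h, h'⟩
  exact ⟨e.symm, fun x => by rw [← h, e.symm_apply_apply],
    fun x => by rw [← h', e.symm_apply_apply]⟩

theorem Iso.trans {m n : ℕ} {c d k : FinCospan m n} : Iso c d → Iso d k → Iso c k := by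
  rintro ⟨e, h, h'⟩ ⟨e', k, k'⟩
  exact ⟨e.trans e', fun x => by rw [Equiv.trans_apply, h, k],
    fun x => by rw [Equiv.trans_apply, h', k']⟩

theorem Iso.comp {a b c : ℕ} {f f' : FinCospan a b} {g g' : FinCospan b c} :
    Iso f f' → Iso g g' → Iso (data.comp f g) (data.comp f' g') := by
  rintro ⟨e, h, h'⟩ ⟨k, l, l'⟩
  refine ⟨Quot.congr (Equiv.sumCongr e k) ?_, fun x => ?_, fun x => ?_⟩
  · rintro (u | u) (v | v) <;> simp [← h', ← l]
  · exact congrArg (fun t => Quot.mk _ (Sum.inl t)) (h x)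
  · exact congrArg (fun t => Quot.mk _ (Sum.inr t)) (l' x)

theorem tensor_left_inl {a b c d : ℕ} (f : FinCospan a b) (g : FinCospan c d) (x : Fin a) :
    (data.tensor f g).left (Fin.castAdd c x) = Sum.inl (f.left x) := by simp [data]

theorem tensor_left_inr {a b c d : ℕ} (f : FinCospan a b) (g : FinCospan c d) (x : Fin c) :
    (data.tensor f g).left (Fin.natAdd a x) = Sum.inr (g.left x) := by simp [data]

theorem tensor_right_inl {a b c d : ℕ} (f : FinCospan a b) (g : FinCospan c d) (x : Fin b) :
    (data.tensor f g).right (Fin.castAdd d x) = Sum.inl (f.right x) := by simp [data]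

theorem tensor_right_inr {a b c d : ℕ} (f : FinCospan a b) (g : FinCospan c d) (x : Fin d) :
    (data.tensor f g).right (Fin.natAdd b x) = Sum.inr (g.right x) := by simp [data]

/-- An isomorphism from a tensor product of cospans can be checked on the summands. -/
theorem Iso.ofTensor {a b c d : ℕ} {f : FinCospan a b} {g : FinCospan c d}
    {k : FinCospan (a + c) (b + d)} (e : f.apex ⊕ g.apex ≃ k.apex)
    (h₁ : ∀ x, e (.inl (f.left x)) = k.left (Fin.castAdd c x))
    (h₂ : ∀ x, e (.inr (g.left x)) = k.left (Fin.natAdd a x))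
    (h₃ : ∀ x, e (.inl (f.right x)) = k.right (Fin.castAdd d x))
    (h₄ : ∀ x, e (.inr (g.right x)) = k.right (Fin.natAdd b x)) :
    Iso (data.tensor f g) k := by
  refine ⟨e, fun x => ?_, fun x => ?_⟩
  · refine Fin.addCases (fun x => ?_) (fun x => ?_) x
    · exact (congrArg e (tensor_left_inl f g x)).trans (h₁ x)
    · exact (congrArg e (tensor_left_inr f g x)).trans (h₂ x)
  · refine Fin.addCases (fun x => ?_) (fun x => ?_) x
    · exact (congrArg e (tensor_right_inl f g x)).trans (h₃ x)
    · exact (congrArg e (tensor_right_inr f g x)).trans (h₄ x)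

theorem Iso.tensor {a b c d : ℕ} {f f' : FinCospan a b} {g g' : FinCospan c d} :
    Iso f f' → Iso g g' → Iso (data.tensor f g) (data.tensor f' g') := by
  rintro ⟨e, h, h'⟩ ⟨k, l, l'⟩
  refine Iso.ofTensor (k := data.tensor f' g') (Equiv.sumCongr e k) ?_ ?_ ?_ ?_ <;> intro x
  · exact (congrArg Sum.inl (h x)).trans (tensor_left_inl f' g' x).symm
  · exact (congrArg Sum.inr (l x)).trans (tensor_left_inr f' g' x).symm
  · exact (congrArg Sum.inl (h' x)).trans (tensor_right_inl f' g' x).symm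
  · exact (congrArg Sum.inr (l' x)).trans (tensor_right_inr f' g' x).symm

/-- Isomorphism of cospans as an equivalence relation. -/
def setoid (m n : ℕ) : Setoid (FinCospan m n) := ⟨Iso, .refl, .symm, .trans⟩

/-- The operations on isomorphism classes of cospans. -/
def classData : PROPData.{1} where
  Hom m n := Quotient (setoid m n)
  id n := Quotient.mk _ (data.id n)
  comp := Quotient.map₂ data.comp fun _ _ h _ _ h' => h.comp h'
  tensor := Quotient.map₂ data.tensor fun _ _ h _ _ h' => h.tensor h'
  swap m n := Quotient.mk _ (data.swap m n)

theorem eqHom_eq {a b : ℕ} (h : a = b) : data.eqHom h = ofFun (Fin.cast h) := by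
  subst h; rfl

theorem classData_eqHom {a b : ℕ} (h : a = b) :
    classData.eqHom h = Quotient.mk _ (data.eqHom h) := by
  subst h; rfl

/-- Isomorphisms can be given by a map that has a two-sided inverse. -/
theorem Iso.mk' {m n : ℕ} {c d : FinCospan m n} (u : c.apex → d.apex) (v : d.apex → c.apex)
    (h : ∀ x, v (u x) = x) (h' : ∀ x, u (v x) = x) (hl : ∀ x, u (c.left x) = d.left x)
    (hr : ∀ x, u (c.right x) = d.right x) : Iso c d :=
  ⟨⟨u, v, h, h'⟩, hl, hr⟩

theorem ofFun_comp {a b c : ℕ} (s : Fin a → Fin b) (f : FinCospan b c) :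
    Iso (data.comp (ofFun s) f) ⟨f.apex, f.finite_apex, f.left ∘ s, f.right⟩ := by
  refine Iso.mk' (Quot.lift (Sum.elim f.left _root_.id) ?_) (fun x => Quot.mk _ (.inr x))
    ?_ ?_ ?_ ?_
  · rintro _ _ ⟨y, rfl, rfl⟩; rfl
  · rintro ⟨u | u⟩
    · exact (glue (ofFun s) f u).symm
    · rfl
  all_goals intro x; rfl

theorem comp_ofFun {a b c : ℕ} (f : FinCospan a b) (s : Fin b → Fin c) (t : Fin c → Fin b)
    (hst : ∀ x, s (t x) = x) (hts : ∀ x, t (s x) = x) :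
    Iso (data.comp f (ofFun s)) ⟨f.apex, f.finite_apex, f.left, f.right ∘ t⟩ := by
  refine Iso.mk' (Quot.lift (Sum.elim _root_.id (f.right ∘ t)) ?_)
    (fun x => Quot.mk _ (.inl x)) ?_ ?_ ?_ ?_
  · rintro _ _ ⟨y, rfl, rfl⟩
    exact congrArg f.right (hts y).symm
  · rintro ⟨u | u⟩
    · rfl
    · exact (glue f (ofFun s) (t u)).trans (congrArg (fun v => Quot.mk _ (Sum.inr v)) (hst u))
  all_goals intro x; rfl

theorem assoc {a b c d : ℕ} (f : FinCospan a b) (g : FinCospan b c) (h : FinCospan c d) :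
    Iso (data.comp (data.comp f g) h) (data.comp f (data.comp g h)) := by
  refine Iso.mk'
    (Quot.lift (Sum.elim
      (Quot.lift (Sum.elim (fun x => Quot.mk _ (.inl x))
        (fun x => Quot.mk _ (.inr (Quot.mk _ (.inl x))))) ?_)
      (fun x => Quot.mk _ (.inr (Quot.mk _ (.inr x))))) ?_)
    (Quot.lift (Sum.elim (fun x => Quot.mk _ (.inl (Quot.mk _ (.inl x))))
      (Quot.lift (Sum.elim (fun x => Quot.mk _ (.inl (Quot.mk _ (.inr x))))
        (fun x => Quot.mk _ (.inr x))) ?_)) ?_) ?_ ?_ ?_ ?_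
  · rintro _ _ ⟨y, rfl, rfl⟩
    exact glue f (data.comp g h) y
  · rintro _ _ ⟨y, rfl, rfl⟩
    exact congrArg (fun t => Quot.mk _ (Sum.inr t)) (glue g h y)
  · rintro _ _ ⟨y, rfl, rfl⟩
    exact glue (data.comp f g) h y
  · rintro _ _ ⟨y, rfl, rfl⟩
    exact congrArg (fun t => Quot.mk _ (Sum.inl t)) (glue f g y)
  · rintro ⟨⟨⟨x | x⟩⟩ | x⟩ <;> rfl
  · rintro ⟨x | ⟨⟨x | x⟩⟩⟩ <;> rfl
  · intro x; rfl
  · intro x; rfl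

theorem interchange {a b c a' b' c' : ℕ} (f : FinCospan a b) (g : FinCospan b c)
    (f' : FinCospan a' b') (g' : FinCospan b' c') :
    Iso (data.tensor (data.comp f g) (data.comp f' g'))
      (data.comp (data.tensor f f') (data.tensor g g')) := by
  let q : ∀ u : (f.apex ⊕ f'.apex) ⊕ (g.apex ⊕ g'.apex),
      Pushout (data.tensor f f') (data.tensor g g') := fun u => Quot.mk _ u
  have key₁ : ∀ y : Fin b, q (.inl (.inl (f.right y))) = q (.inr (.inl (g.left y))) := fun y =>
    Quot.sound ⟨Fin.castAdd b' y, congrArg Sum.inl (tensor_right_inl f f' y).symm,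
      congrArg Sum.inr (tensor_left_inl g g' y).symm⟩
  have key₂ : ∀ y : Fin b', q (.inl (.inr (f'.right y))) = q (.inr (.inr (g'.left y))) :=
    fun y => Quot.sound ⟨Fin.natAdd b y, congrArg Sum.inl (tensor_right_inr f f' y).symm,
      congrArg Sum.inr (tensor_left_inr g g' y).symm⟩
  let e : Pushout f g ⊕ Pushout f' g' ≃ Pushout (data.tensor f f') (data.tensor g g') :=
    { toFun := Sum.elim
        (Quot.lift (Sum.elim (fun x => q (.inl (.inl x))) (fun x => q (.inr (.inl x))))
          (by rintro _ _ ⟨y, rfl, rfl⟩; exact key₁ y))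
        (Quot.lift (Sum.elim (fun x => q (.inl (.inr x))) (fun x => q (.inr (.inr x))))
          (by rintro _ _ ⟨y, rfl, rfl⟩; exact key₂ y))
      invFun := Quot.lift (Sum.elim
        (Sum.map (fun x => Quot.mk _ (.inl x)) (fun x => Quot.mk _ (.inl x)))
        (Sum.map (fun x => Quot.mk _ (.inr x)) (fun x => Quot.mk _ (.inr x)))) (by
          rintro _ _ ⟨y, rfl, rfl⟩
          refine Fin.addCases (fun y => ?_) (fun y => ?_) y
          · rw [tensor_right_inl, tensor_left_inl]
            exact congrArg Sum.inl (glue f g y)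
          · rw [tensor_right_inr, tensor_left_inr]
            exact congrArg Sum.inr (glue f' g' y))
      left_inv := by rintro (⟨⟨x | x⟩⟩ | ⟨⟨x | x⟩⟩) <;> rfl
      right_inv := by rintro ⟨(x | x) | (x | x)⟩ <;> rfl }
  refine Iso.ofTensor (f := data.comp f g) (g := data.comp f' g')
    (k := data.comp (data.tensor f f') (data.tensor g g')) e ?_ ?_ ?_ ?_ <;> intro x
  · exact congrArg (fun t => q (.inl t)) (tensor_left_inl f f' x).symm
  · exact congrArg (fun t => q (.inl t)) (tensor_left_inr f f' x).symm
  · exact congrArg (fun t => q (.inr t)) (tensor_right_inl g g' x).symm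
  · exact congrArg (fun t => q (.inr t)) (tensor_right_inr g g' x).symm

theorem tensor_ofFun {a b c d : ℕ} (s : Fin a → Fin b) (t : Fin c → Fin d)
    (w : Fin (a + c) → Fin (b + d)) (hs : ∀ x, w (Fin.castAdd c x) = Fin.castAdd d (s x))
    (ht : ∀ x, w (Fin.natAdd a x) = Fin.natAdd b (t x)) :
    Iso (data.tensor (ofFun s) (ofFun t)) (ofFun w) :=
  Iso.ofTensor (f := ofFun s) (g := ofFun t) (k := ofFun w) finSumFinEquiv
    (fun x => (hs x).symm) (fun x => (ht x).symm) (fun _ => rfl) (fun _ => rfl)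

theorem cast_natAdd (a b c : ℕ) (x : Fin c) :
    Fin.cast (Nat.add_assoc a b c) (Fin.natAdd (a + b) x) = Fin.natAdd a (Fin.natAdd b x) :=
  Fin.ext (by simp [Nat.add_assoc])

theorem cast_castAdd_natAdd (a b c : ℕ) (x : Fin b) :
    Fin.cast (Nat.add_assoc a b c) (Fin.castAdd c (Fin.natAdd a x)) =
      Fin.natAdd a (Fin.castAdd c x) := rfl

theorem cast_castAdd_castAdd (a b c : ℕ) (x : Fin a) :
    Fin.cast (Nat.add_assoc a b c) (Fin.castAdd c (Fin.castAdd b x)) = Fin.castAdd (b + c) x :=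
  rfl

theorem ofFun_comp_ofFun {a b c : ℕ} (s : Fin a → Fin b) (t : Fin b → Fin c) :
    Iso (data.comp (ofFun s) (ofFun t)) (ofFun (t ∘ s)) :=
  ofFun_comp s (ofFun t)

end FinCospan

open FinCospan in
/-- The PROP of cospans of finite sets: objects are the finite sets `{1, …, n}`, morphisms are
isomorphism classes of cospans, composition is by pushout and tensor by disjoint union. -/
def CospanFinSet : PROP.{1} where
  toPROPData := classData
  id_comp := by rintro a b ⟨f⟩; exact Quotient.sound (ofFun_comp _ f)
  comp_id := by
    rintro a b ⟨f⟩
    exact Quotient.sound (comp_ofFun f id id (fun _ => rfl) (fun _ => rfl))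
  assoc := by rintro a b c d ⟨f⟩ ⟨g⟩ ⟨h⟩; exact Quotient.sound (assoc f g h)
  tensor_id m n := Quotient.sound (tensor_ofFun id id id (fun _ => rfl) (fun _ => rfl))
  interchange := by
    rintro a b c a' b' c' ⟨f⟩ ⟨g⟩ ⟨f'⟩ ⟨g'⟩
    exact Quotient.sound (interchange f g f' g')
  tensor_assoc := by
    rintro a a' b b' c c' ⟨f⟩ ⟨g⟩ ⟨h⟩
    simp only [classData_eqHom, eqHom_eq]
    refine Quotient.sound ((comp_ofFun _ _ (Fin.cast (Nat.add_assoc a' b' c').symm)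
      (fun _ => rfl) (fun _ => rfl)).trans (Iso.trans ?_ (ofFun_comp _ _).symm))
    refine ⟨Equiv.sumAssoc f.apex g.apex h.apex, fun x => ?_, fun x => ?_⟩
    · refine Fin.addCases (fun x => Fin.addCases (fun x => ?_) (fun x => ?_) x) (fun x => ?_) x
      · have L := tensor_left_inr (data.tensor f g) h x
        have R := (tensor_left_inr f (data.tensor g h) _).trans
          (congrArg Sum.inr (tensor_left_inr g h x))
        exact (congrArg (Equiv.sumAssoc f.apex g.apex h.apex) L).trans (R.symm.trans
          (congrArg (data.tensor f (data.tensor g h)).left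
            (Fin.ext (by simp [Nat.add_assoc]))))
      · have L := (tensor_left_inl (data.tensor f g) h _).trans
          (congrArg Sum.inl (tensor_left_inl f g x))
        have R := tensor_left_inl f (data.tensor g h) x
        exact (congrArg (Equiv.sumAssoc f.apex g.apex h.apex) L).trans (R.symm.trans
          (congrArg (data.tensor f (data.tensor g h)).left (Fin.ext (by simp))))
      · have L := (tensor_left_inl (data.tensor f g) h _).trans
          (congrArg Sum.inl (tensor_left_inr f g x))
        have R := (tensor_left_inr f (data.tensor g h) _).trans
          (congrArg Sum.inr (tensor_left_inl g h x))
        exact (congrArg (Equiv.sumAssoc f.apex g.apex h.apex) L).trans (R.symm.trans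
          (congrArg (data.tensor f (data.tensor g h)).left (Fin.ext (by simp))))
    · obtain ⟨x, rfl⟩ := (finCongr (Nat.add_assoc a' b' c')).surjective x
      refine Fin.addCases (fun x => Fin.addCases (fun x => ?_) (fun x => ?_) x) (fun x => ?_) x
      · have L := tensor_right_inr (data.tensor f g) h x
        have R := (tensor_right_inr f (data.tensor g h) _).trans
          (congrArg Sum.inr (tensor_right_inr g h x))
        exact (congrArg (Equiv.sumAssoc f.apex g.apex h.apex) L).trans (R.symm.trans
          (congrArg (data.tensor f (data.tensor g h)).right
            (Fin.ext (by simp [Nat.add_assoc]))))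
      · have L := (tensor_right_inl (data.tensor f g) h _).trans
          (congrArg Sum.inl (tensor_right_inl f g x))
        have R := tensor_right_inl f (data.tensor g h) x
        exact (congrArg (Equiv.sumAssoc f.apex g.apex h.apex) L).trans (R.symm.trans
          (congrArg (data.tensor f (data.tensor g h)).right (Fin.ext (by simp))))
      · have L := (tensor_right_inl (data.tensor f g) h _).trans
          (congrArg Sum.inl (tensor_right_inr f g x))
        have R := (tensor_right_inr f (data.tensor g h) _).trans
          (congrArg Sum.inr (tensor_right_inl g h x))
        exact (congrArg (Equiv.sumAssoc f.apex g.apex h.apex) L).trans (R.symm.trans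
          (congrArg (data.tensor f (data.tensor g h)).right (Fin.ext (by simp))))
  unit_tensor := by
    rintro a b ⟨f⟩
    simp only [classData_eqHom, eqHom_eq]
    refine Quotient.sound ((comp_ofFun _ _ (Fin.cast (Nat.zero_add b).symm)
      (fun _ => rfl) (fun _ => rfl)).trans (Iso.trans ?_ (ofFun_comp _ _).symm))
    refine Iso.symm ⟨(Equiv.emptySum (Fin 0) f.apex).symm, fun x => ?_, fun x => ?_⟩
    · refine Fin.addCases (fun x => x.elim0) (fun x => ?_) x
      refine Eq.trans ?_ (tensor_left_inr (ofFun (id : Fin 0 → Fin 0)) f x).symm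
      exact congrArg (fun t => Sum.inr (f.left t)) (Fin.ext (by simp))
    · refine Eq.trans (tensor_right_inr (ofFun (id : Fin 0 → Fin 0)) f x).symm ?_
      exact congrArg (data.tensor (ofFun (id : Fin 0 → Fin 0)) f).right (Fin.ext (by simp))
  tensor_unit := by
    rintro a b ⟨f⟩
    simp only [classData_eqHom, eqHom_eq]
    refine Quotient.sound ((comp_ofFun _ _ (Fin.cast (Nat.add_zero b).symm)
      (fun _ => rfl) (fun _ => rfl)).trans (Iso.trans ?_ (ofFun_comp _ _).symm))
    refine Iso.symm ⟨(Equiv.sumEmpty f.apex (Fin 0)).symm, fun x => ?_, fun x => ?_⟩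
    · exact (tensor_left_inl f (ofFun (id : Fin 0 → Fin 0)) x).symm
    · exact (tensor_right_inl f (ofFun (id : Fin 0 → Fin 0)) x).symm
  swap_natural := by
    rintro a a' b b' ⟨f⟩ ⟨g⟩
    refine Quotient.sound ((comp_ofFun _ _ finAddFlip
      (finAddFlip (m := a') (n := b')).apply_symm_apply
      (finAddFlip (m := a') (n := b')).symm_apply_apply).trans
      (Iso.trans ?_ (ofFun_comp _ _).symm))
    refine ⟨Equiv.sumComm f.apex g.apex, fun x => ?_, fun x => ?_⟩
    · refine Fin.addCases (fun x => ?_) (fun x => ?_) x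
      · rw [tensor_left_inl]
        change _ = (data.tensor g f).left (finAddFlip (Fin.castAdd b x))
        rw [finAddFlip_apply_castAdd, tensor_left_inr]
        rfl
      · rw [tensor_left_inr]
        change _ = (data.tensor g f).left (finAddFlip (Fin.natAdd a x))
        rw [finAddFlip_apply_natAdd, tensor_left_inl]
        rfl
    · change (Equiv.sumComm f.apex g.apex) ((data.tensor f g).right (finAddFlip x)) = _
      refine Fin.addCases (fun x => ?_) (fun x => ?_) x
      · rw [finAddFlip_apply_castAdd, tensor_right_inr, tensor_right_inl]
        rfl
      · rw [finAddFlip_apply_natAdd, tensor_right_inl, tensor_right_inr]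
        rfl
  swap_swap m n := by
    refine Quotient.sound ((ofFun_comp_ofFun _ _).trans ?_)
    have : (finAddFlip ∘ finAddFlip : Fin (m + n) → _) = id :=
      funext (finAddFlip (m := m) (n := n)).symm_apply_apply
    rw [this]
    exact .refl _
  hexagon m n p := by
    simp only [classData_eqHom, eqHom_eq]
    let w₁ : Fin (m + n + p) → Fin (n + m + p) :=
      Fin.addCases (fun x => Fin.castAdd p (finAddFlip x)) (fun x => Fin.natAdd (n + m) x)
    let w₂ : Fin (n + (m + p)) → Fin (n + (p + m)) :=
      Fin.addCases (fun x => Fin.castAdd (p + m) x) (fun x => Fin.natAdd n (finAddFlip x))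
    have h₁ : Iso (data.tensor (ofFun finAddFlip) (ofFun id)) (ofFun w₁) :=
      tensor_ofFun _ _ _ (fun x => by simp [w₁]) (fun x => by simp [w₁])
    have h₂ : Iso (data.tensor (ofFun id) (ofFun finAddFlip)) (ofFun w₂) :=
      tensor_ofFun _ _ _ (fun x => by simp [w₂]) (fun x => by simp [w₂])
    refine Quotient.sound ((Iso.comp h₁
      ((Iso.comp (.refl _) h₂).trans (ofFun_comp_ofFun _ _))).trans
      ((ofFun_comp_ofFun _ _).trans (Iso.trans ?_ ((Iso.comp (.refl _)
        (ofFun_comp_ofFun _ _)).trans (ofFun_comp_ofFun _ _)).symm)))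
    refine (fun h => h ▸ Iso.refl _ : ∀ {s t : Fin (m + n + p) → Fin (n + (p + m))},
      s = t → Iso (ofFun s) (ofFun t)) ?_
    funext x
    refine Fin.addCases (fun x => Fin.addCases (fun x => ?_) (fun x => ?_) x) (fun x => ?_) x
    · simp [w₁, w₂, cast_natAdd, cast_castAdd_natAdd]
    · simp [w₁, w₂, cast_castAdd_natAdd, cast_castAdd_castAdd, cast_natAdd]
    · simp [w₁, w₂, cast_castAdd_natAdd, cast_castAdd_castAdd]

/-- A corelation from `{1, …, m}` to `{1, …, n}`: an equivalence relation on the disjoint union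
`{1, …, m} ⊔ {1, …, n}`. -/
abbrev FinCorelation (m n : ℕ) : Type := Setoid (Fin m ⊕ Fin n)

namespace FinCorelation

/-- The union of two relations `R` on `m ⊔ n` and `S` on `n ⊔ p`, as a relation on
`m ⊔ n ⊔ p`. -/
inductive Union {a b c : ℕ} (R : FinCorelation a b) (S : FinCorelation b c) :
    Fin a ⊕ Fin b ⊕ Fin c → Fin a ⊕ Fin b ⊕ Fin c → Prop
  | left {u v : Fin a ⊕ Fin b} (h : R u v) :
      Union R S (Sum.map id Sum.inl u) (Sum.map id Sum.inl v)
  | right {u v : Fin b ⊕ Fin c} (h : S u v) : Union R S (Sum.inr u) (Sum.inr v)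

theorem Union.refl {a b c : ℕ} (R : FinCorelation a b) (S : FinCorelation b c)
    (u : Fin a ⊕ Fin b ⊕ Fin c) : Union R S u u := by
  rcases u with u | u
  · exact Union.left (u := .inl u) (R.refl _)
  · exact Union.right (S.refl _)

theorem Union.symm {a b c : ℕ} {R : FinCorelation a b} {S : FinCorelation b c}
    {u v : Fin a ⊕ Fin b ⊕ Fin c} : Union R S u v → Union R S v u
  | .left h => .left (R.symm h)
  | .right h => .right (S.symm h)

/-- The transitive closure of the union of two corelations. -/
def closure {a b c : ℕ} (R : FinCorelation a b) (S : FinCorelation b c) :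
    Setoid (Fin a ⊕ Fin b ⊕ Fin c) where
  r := Relation.TransGen (Union R S)
  iseqv := ⟨fun u => .single (Union.refl R S u),
    fun h => by
      induction h with
      | single h => exact .single h.symm
      | tail _ h ih => exact .head h.symm ih,
    fun h h' => h.trans h'⟩

/-- The disjoint union of two equivalence relations. -/
def sum {α β : Type} (R : Setoid α) (S : Setoid β) : Setoid (α ⊕ β) where
  r := Sum.LiftRel R S
  iseqv := by
    refine ⟨fun u => ?_, fun h => ?_, fun h k => ?_⟩
    · rcases u with x | x
      · exact .inl (R.refl x)
      · exact .inr (S.refl x)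
    · rcases h with h | h
      · exact .inl (R.symm h)
      · exact .inr (S.symm h)
    · rcases h with h | h <;> rcases k with k | k
      · exact .inl (R.trans h k)
      · exact .inr (S.trans h k)

/-- The identification of `{1, …, m + m'} ⊔ {1, …, n + n'}` with
`({1, …, m} ⊔ {1, …, n}) ⊔ ({1, …, m'} ⊔ {1, …, n'})`. -/
def split (a b c d : ℕ) : Fin (a + c) ⊕ Fin (b + d) ≃ (Fin a ⊕ Fin b) ⊕ (Fin c ⊕ Fin d) :=
  (Equiv.sumCongr finSumFinEquiv.symm finSumFinEquiv.symm).trans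
    (Equiv.sumSumSumComm (Fin a) (Fin c) (Fin b) (Fin d))

/-- The graph of a map of finite sets: every input is identified with its image. -/
abbrev graph {m n : ℕ} (s : Fin m → Fin n) : FinCorelation m n := Setoid.ker (Sum.elim s id)

/-- Identities, composition, tensor and symmetries of corelations. The composite is the
restriction to the outer boundary of the transitive closure of the union of the two relations,
the tensor is the disjoint union, the symmetry is the graph of the block transposition. -/
def data : PROPData.{0} where
  Hom := FinCorelation
  id _ := graph id
  comp R S := (closure R S).comap (Sum.map id Sum.inr)
  tensor {a b c d} R S := (sum R S).comap (split a b c d)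
  swap _ _ := graph finAddFlip

end FinCorelation

namespace FinCospan

/-- The corelation of a cospan: the kernel of its joint map. -/
abbrev ker {m n : ℕ} (c : FinCospan m n) : FinCorelation m n := Setoid.ker c.joint

theorem Iso.ker_eq {m n : ℕ} {c d : FinCospan m n} : Iso c d → c.ker = d.ker := by
  rintro ⟨e, h, h'⟩
  have key : ∀ u, d.joint u = e (c.joint u) := by
    rintro (u | u)
    · exact (h u).symm
    · exact (h' u).symm
  refine Setoid.ext fun u v => ?_
  change c.joint u = c.joint v ↔ d.joint u = d.joint v
  rw [key, key, e.apply_eq_iff_eq]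

theorem ker_ofFun {m n : ℕ} (s : Fin m → Fin n) : (ofFun s).ker = FinCorelation.graph s := rfl

theorem ker_tensor {a b c d : ℕ} (f : FinCospan a b) (g : FinCospan c d) :
    (data.tensor f g).ker = FinCorelation.data.tensor f.ker g.ker := by
  have key : ∀ u, (data.tensor f g).joint u =
      Sum.map f.joint g.joint (FinCorelation.split a b c d u) := by
    rintro (u | u) <;> obtain ⟨u | u, rfl⟩ := finSumFinEquiv.surjective u
    all_goals simp [joint, FinCorelation.split, tensor_left_inl, tensor_left_inr,
      tensor_right_inl, tensor_right_inr, Equiv.sumSumSumComm] <;> rfl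
  refine Setoid.ext fun u v => ?_
  change (data.tensor f g).joint u = (data.tensor f g).joint v ↔ Sum.LiftRel _ _ _ _
  rw [key, key]
  rcases FinCorelation.split a b c d u with x | x <;>
    rcases FinCorelation.split a b c d v with y | y
  · exact Sum.inl_injective.eq_iff.trans ⟨fun h => .inl h, fun h => by cases h; assumption⟩
  · exact iff_of_false Sum.inl_ne_inr Sum.not_liftRel_inl_inr
  · exact iff_of_false Sum.inr_ne_inl Sum.not_liftRel_inr_inl
  · exact Sum.inr_injective.eq_iff.trans ⟨fun h => .inr h, fun h => by cases h; assumption⟩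

theorem ker_comp {a b c : ℕ} (f : FinCospan a b) (g : FinCospan b c) :
    (data.comp f g).ker = FinCorelation.data.comp f.ker g.ker := by
  let C := FinCorelation.closure f.ker g.ker
  let i : Fin a ⊕ Fin b → Fin a ⊕ Fin b ⊕ Fin c := Sum.map id Sum.inl
  let p : Fin a ⊕ Fin b ⊕ Fin c → Pushout f g :=
    Sum.elim (fun x => Quot.mk _ (.inl (f.left x))) (fun x => Quot.mk _ (.inr (g.joint x)))
  have pi : ∀ u, p (i u) = Quot.mk _ (.inl (f.joint u)) := by
    rintro (u | u)
    · rfl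
    · exact (glue f g u).symm
  have fwd : ∀ u v, C u v → p u = p v := by
    intro u v h
    induction h with
    | single h =>
      rcases h with h | h
      · exact (pi _).trans ((congrArg (fun t => Quot.mk _ (Sum.inl t)) h).trans (pi _).symm)
      · exact congrArg (fun t => Quot.mk _ (Sum.inr t)) h
    | tail _ h ih =>
      refine ih.trans ?_
      rcases h with h | h
      · exact (pi _).trans ((congrArg (fun t => Quot.mk _ (Sum.inl t)) h).trans (pi _).symm)
      · exact congrArg (fun t => Quot.mk _ (Sum.inr t)) h
  let D : f.apex ⊕ g.apex → Set (Quotient C) := Sum.elim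
    (fun t => {q | ∃ u, f.joint u = t ∧ q = Quotient.mk C (i u)})
    (fun t => {q | ∃ u, g.joint u = t ∧ q = Quotient.mk C (.inr u)})
  have Dl : ∀ u, D (.inl (f.joint u)) = {Quotient.mk C (i u)} := by
    intro u
    ext q
    constructor
    · rintro ⟨v, h, rfl⟩
      exact Quotient.sound (Relation.TransGen.single (.left h))
    · rintro rfl
      exact ⟨u, rfl, rfl⟩
  have Dr : ∀ u, D (.inr (g.joint u)) = {Quotient.mk C (.inr u)} := by
    intro u
    ext q
    constructor
    · rintro ⟨v, h, rfl⟩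
      exact Quotient.sound (Relation.TransGen.single (.right h))
    · rintro rfl
      exact ⟨u, rfl, rfl⟩
  let D' : Pushout f g → Set (Quotient C) := Quot.lift D (by
    rintro _ _ ⟨y, rfl, rfl⟩
    exact (Dl (.inr y)).trans (Dr (.inl y)).symm)
  have Dp : ∀ u, D' (p u) = {Quotient.mk C u} := by
    rintro (u | u)
    · exact Dl (.inl u)
    · exact Dr u
  have bwd : ∀ u v, p u = p v → C u v := by
    intro u v h
    have := congrArg D' h
    rw [Dp, Dp, Set.singleton_eq_singleton_iff] at this
    exact Quotient.exact this
  have joint_eq : ∀ u, (data.comp f g).joint u = p (Sum.map id Sum.inr u) := by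
    rintro (u | u) <;> rfl
  refine Setoid.ext fun u v => ?_
  change (data.comp f g).joint u = (data.comp f g).joint v ↔ C _ _
  rw [joint_eq, joint_eq]
  exact ⟨bwd _ _, fwd _ _⟩

/-- Every corelation is the kernel of the cospan formed by its quotient. -/
theorem exists_ker_eq {m n : ℕ} (R : FinCorelation m n) : ∃ c : FinCospan m n, c.ker = R := by
  refine ⟨⟨Quotient R, Quotient.finite _, fun x => Quotient.mk R (.inl x),
    fun x => Quotient.mk R (.inr x)⟩, ?_⟩
  refine Setoid.ext fun u v => ?_
  rcases u with u | u <;> rcases v with v | v <;> exact Quotient.eq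

end FinCospan

namespace FinCospan

/-- The corelation of an isomorphism class of cospans. -/
abbrev kerClass {m n : ℕ} : CospanFinSet.Hom m n → FinCorelation m n :=
  Quotient.lift ker fun _ _ h => Iso.ker_eq h

theorem kerClass_surjective (m n : ℕ) :
    Function.Surjective (kerClass (m := m) (n := n)) := fun R =>
  let ⟨c, h⟩ := exists_ker_eq R
  ⟨Quotient.mk _ c, h⟩

theorem kerClass_id (n : ℕ) : kerClass (CospanFinSet.id n) = FinCorelation.data.id n := rfl

theorem kerClass_swap (m n : ℕ) :
    kerClass (CospanFinSet.swap m n) = FinCorelation.data.swap m n := rfl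

theorem kerClass_comp {a b c : ℕ} (f : CospanFinSet.Hom a b) (g : CospanFinSet.Hom b c) :
    kerClass (CospanFinSet.comp f g) = FinCorelation.data.comp (kerClass f) (kerClass g) := by
  obtain ⟨f⟩ := f
  obtain ⟨g⟩ := g
  exact ker_comp f g

theorem kerClass_tensor {a b c d : ℕ} (f : CospanFinSet.Hom a b) (g : CospanFinSet.Hom c d) :
    kerClass (CospanFinSet.tensor f g) =
      FinCorelation.data.tensor (kerClass f) (kerClass g) := by
  obtain ⟨f⟩ := f
  obtain ⟨g⟩ := g
  exact ker_tensor f g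

theorem kerClass_eqHom {a b : ℕ} (h : a = b) :
    kerClass (CospanFinSet.eqHom h) = FinCorelation.data.eqHom h := by
  subst h; rfl

end FinCospan

open FinCospan in
/-- The PROP of corelations of finite sets. The laws are transferred from cospans, along the
operation that takes a cospan to the kernel of its joint map. -/
def FinCorel : PROP.{0} where
  toPROPData := FinCorelation.data
  id_comp := by
    intro a b f
    obtain ⟨f, rfl⟩ := kerClass_surjective _ _ f
    have key := congrArg kerClass (CospanFinSet.id_comp f)
    simp only [kerClass_comp, kerClass_id] at key
    exact key
  comp_id := by
    intro a b f
    obtain ⟨f, rfl⟩ := kerClass_surjective _ _ f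
    have key := congrArg kerClass (CospanFinSet.comp_id f)
    simp only [kerClass_comp, kerClass_id] at key
    exact key
  assoc := by
    intro a b c d f g h
    obtain ⟨f, rfl⟩ := kerClass_surjective _ _ f
    obtain ⟨g, rfl⟩ := kerClass_surjective _ _ g
    obtain ⟨h, rfl⟩ := kerClass_surjective _ _ h
    have key := congrArg kerClass (CospanFinSet.assoc f g h)
    simp only [kerClass_comp] at key
    exact key
  tensor_id := by
    intro m n
    have key := congrArg kerClass (CospanFinSet.tensor_id m n)
    simp only [kerClass_tensor, kerClass_id] at key
    exact key
  interchange := by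
    intro a b c a' b' c' f g f' g'
    obtain ⟨f, rfl⟩ := kerClass_surjective _ _ f
    obtain ⟨g, rfl⟩ := kerClass_surjective _ _ g
    obtain ⟨f', rfl⟩ := kerClass_surjective _ _ f'
    obtain ⟨g', rfl⟩ := kerClass_surjective _ _ g'
    have key := congrArg kerClass (CospanFinSet.interchange f g f' g')
    simp only [kerClass_comp, kerClass_tensor] at key
    exact key
  tensor_assoc := by
    intro a a' b b' c c' f g h
    obtain ⟨f, rfl⟩ := kerClass_surjective _ _ f
    obtain ⟨g, rfl⟩ := kerClass_surjective _ _ g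
    obtain ⟨h, rfl⟩ := kerClass_surjective _ _ h
    have key := congrArg kerClass (CospanFinSet.tensor_assoc f g h)
    simp only [kerClass_comp, kerClass_tensor, kerClass_eqHom] at key
    exact key
  unit_tensor := by
    intro a b f
    obtain ⟨f, rfl⟩ := kerClass_surjective _ _ f
    have key := congrArg kerClass (CospanFinSet.unit_tensor f)
    simp only [kerClass_comp, kerClass_tensor, kerClass_id, kerClass_eqHom] at key
    exact key
  tensor_unit := by
    intro a b f
    obtain ⟨f, rfl⟩ := kerClass_surjective _ _ f
    have key := congrArg kerClass (CospanFinSet.tensor_unit f)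
    simp only [kerClass_comp, kerClass_tensor, kerClass_id, kerClass_eqHom] at key
    exact key
  swap_natural := by
    intro a a' b b' f g
    obtain ⟨f, rfl⟩ := kerClass_surjective _ _ f
    obtain ⟨g, rfl⟩ := kerClass_surjective _ _ g
    have key := congrArg kerClass (CospanFinSet.swap_natural f g)
    simp only [kerClass_comp, kerClass_tensor, kerClass_swap] at key
    exact key
  swap_swap := by
    intro m n
    have key := congrArg kerClass (CospanFinSet.swap_swap m n)
    simp only [kerClass_comp, kerClass_id, kerClass_swap] at key
    exact key
  hexagon := by
    intro m n p
    have key := congrArg kerClass (CospanFinSet.hexagon m n p)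
    simp only [kerClass_comp, kerClass_tensor, kerClass_id, kerClass_swap, kerClass_eqHom] at key
    exact key

/-! ### Towers: Frobenius structure with wires adjoined one at a time on the right. -/

/-- A category on the natural numbers with an endofunctor `T` (adjoining a last wire), and an
extraspecial commutative Frobenius structure on the last wires that is natural in the others. -/
structure Tower where
  Hom : ℕ → ℕ → Type
  id : ∀ n : ℕ, Hom n n
  comp : ∀ {a b c : ℕ}, Hom a b → Hom b c → Hom a c
  T : ∀ {a b : ℕ}, Hom a b → Hom (a + 1) (b + 1)
  m : ∀ n : ℕ, Hom (n + 1 + 1) (n + 1)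
  u : ∀ n : ℕ, Hom n (n + 1)
  d : ∀ n : ℕ, Hom (n + 1) (n + 1 + 1)
  e : ∀ n : ℕ, Hom (n + 1) n
  s : ∀ n : ℕ, Hom (n + 1 + 1) (n + 1 + 1)
  id_comp : ∀ {a b : ℕ} (f : Hom a b), comp (id a) f = f
  comp_id : ∀ {a b : ℕ} (f : Hom a b), comp f (id b) = f
  assoc : ∀ {a b c d : ℕ} (f : Hom a b) (g : Hom b c) (h : Hom c d),
    comp (comp f g) h = comp f (comp g h)
  T_id : ∀ n : ℕ, T (id n) = id (n + 1)
  T_comp : ∀ {a b c : ℕ} (f : Hom a b) (g : Hom b c), T (comp f g) = comp (T f) (T g)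
  m_nat : ∀ {a b : ℕ} (f : Hom a b), comp (T (T f)) (m b) = comp (m a) (T f)
  u_nat : ∀ {a b : ℕ} (f : Hom a b), comp f (u b) = comp (u a) (T f)
  d_nat : ∀ {a b : ℕ} (f : Hom a b), comp (T f) (d b) = comp (d a) (T (T f))
  e_nat : ∀ {a b : ℕ} (f : Hom a b), comp (T f) (e b) = comp (e a) f
  s_nat : ∀ {a b : ℕ} (f : Hom a b), comp (T (T f)) (s b) = comp (s a) (T (T f))
  m_assoc : ∀ n : ℕ, comp (T (m n)) (m n) = comp (m (n + 1)) (m n)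
  u_m : ∀ n : ℕ, comp (u (n + 1)) (m n) = id (n + 1)
  s_m : ∀ n : ℕ, comp (s n) (m n) = m n
  d_coassoc : ∀ n : ℕ, comp (d n) (T (d n)) = comp (d n) (d (n + 1))
  d_e : ∀ n : ℕ, comp (d n) (e (n + 1)) = id (n + 1)
  d_s : ∀ n : ℕ, comp (d n) (s n) = d n
  frobenius_left : ∀ n : ℕ, comp (T (d n)) (m (n + 1)) = comp (m n) (d n)
  frobenius_right : ∀ n : ℕ, comp (d (n + 1)) (T (m n)) = comp (m n) (d n)
  d_m : ∀ n : ℕ, comp (d n) (m n) = id (n + 1)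
  u_e : ∀ n : ℕ, comp (u n) (e n) = id n
  s_s : ∀ n : ℕ, comp (s n) (s n) = id (n + 1 + 1)
  yang_baxter : ∀ n : ℕ, comp (T (s n)) (comp (s (n + 1)) (T (s n))) =
    comp (s (n + 1)) (comp (T (s n)) (s (n + 1)))
  Tm_s : ∀ n : ℕ, comp (T (m n)) (s n) = comp (s (n + 1)) (comp (T (s n)) (m (n + 1)))
  s_Td : ∀ n : ℕ, comp (s n) (T (d n)) = comp (d (n + 1)) (comp (T (s n)) (s (n + 1)))
  u_s : ∀ n : ℕ, comp (u (n + 1)) (s n) = T (u n)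
  s_e : ∀ n : ℕ, comp (s n) (e (n + 1)) = T (e n)

/-! ### Merging, copying and linking of wires in a tower. -/

namespace Tower

local infixr:80 " ≫ " => Tower.comp _

variable (X : Tower)

/-- Composites are kept nested to the right; this applies an equation between composites at the head
of a longer one. -/
theorem reassoc {a b c d : ℕ} {f : X.Hom a b} {g : X.Hom b c} {k : X.Hom a c} (h : f ≫ g = k)
    (r : X.Hom c d) : f ≫ g ≫ r = k ≫ r := by
  rw [← h, X.assoc]

theorem reassoc₃ {a b b' c d : ℕ} {f : X.Hom a b} {g : X.Hom b b'} {g' : X.Hom b' c}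
    {k : X.Hom a c} (h : f ≫ g ≫ g' = k) (r : X.Hom c d) : f ≫ g ≫ g' ≫ r = k ≫ r := by
  rw [← h, X.assoc, X.assoc]

theorem s_cancel {a n : ℕ} {f g : X.Hom (n + 1 + 1) a} (h : X.s n ≫ f = X.s n ≫ g) : f = g := by
  rw [← X.id_comp f, ← X.id_comp g, ← X.s_s, X.assoc, X.assoc, h]

theorem Ts_Ts (n : ℕ) : X.T (X.s n) ≫ X.T (X.s n) = X.id _ := by
  rw [← X.T_comp, X.s_s, X.T_id]

/-- This and the next four identities are the tower axioms about crossings, solved for the other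
side by means of the involution `s`. -/
theorem m_s (n : ℕ) : X.m (n + 1) ≫ X.s n = X.T (X.s n) ≫ X.s (n + 1) ≫ X.T (X.m n) := by
  rw [← X.comp_id (X.T (X.m n)), ← X.s_s n, X.reassoc (X.Tm_s n), X.assoc, X.assoc,
    X.reassoc (X.s_s (n + 1)), X.id_comp, X.reassoc (X.Ts_Ts n), X.id_comp]

theorem s_d (n : ℕ) : X.s n ≫ X.d (n + 1) = X.T (X.d n) ≫ X.s (n + 1) ≫ X.T (X.s n) := by
  apply X.s_cancel
  rw [X.reassoc (X.s_s n), X.id_comp, X.reassoc (X.s_Td n), X.assoc, X.assoc,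
    X.reassoc (X.s_s (n + 1)), X.id_comp, X.Ts_Ts, X.comp_id]

theorem Tu_s (n : ℕ) : X.T (X.u n) ≫ X.s n = X.u (n + 1) := by
  rw [← X.u_s, X.assoc, X.s_s, X.comp_id]

theorem s_Te (n : ℕ) : X.s n ≫ X.T (X.e n) = X.e (n + 1) := by
  rw [← X.s_e, X.reassoc (X.s_s n), X.id_comp]

/-- Merge the last wire into the wire `j`. -/
def act : ∀ {n : ℕ}, Fin n → X.Hom (n + 1) n
  | 0, j => j.elim0
  | n + 1, j => Fin.lastCases (motive := fun _ => X.Hom (n + 1 + 1) (n + 1)) (X.m n)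
      (fun j => X.s n ≫ X.T (act j)) j

/-- Copy the wire `j` to a new last wire. -/
def coact : ∀ {n : ℕ}, Fin n → X.Hom n (n + 1)
  | 0, j => j.elim0
  | n + 1, j => Fin.lastCases (motive := fun _ => X.Hom (n + 1) (n + 1 + 1)) (X.d n)
      (fun j => X.T (coact j) ≫ X.s n) j

theorem act_last (n : ℕ) : X.act (Fin.last n) = X.m n := by
  rw [act, Fin.lastCases_last]

/-- The crossing exchanges the extra wire with the last of the wires that stay, so that `T (act j)`
merges the extra wire and leaves the other one alone. -/
theorem act_castSucc {n : ℕ} (j : Fin n) : X.act j.castSucc = X.s n ≫ X.T (X.act j) := by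
  rw [act, Fin.lastCases_castSucc]

theorem coact_last (n : ℕ) : X.coact (Fin.last n) = X.d n := by
  rw [coact, Fin.lastCases_last]

theorem coact_castSucc {n : ℕ} (j : Fin n) :
    X.coact j.castSucc = X.T (X.coact j) ≫ X.s n := by
  rw [coact, Fin.lastCases_castSucc]

/-- Two extra wires can be merged in either order. If both targets are the last wire, this is
associativity with commutativity; if one is, it is the passage of a multiplication through a
crossing; otherwise Yang–Baxter reduces it to fewer wires. -/
theorem act_act {n : ℕ} (i j : Fin n) :
    X.T (X.act i) ≫ X.act j = X.s n ≫ X.T (X.act j) ≫ X.act i := by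
  induction n with
  | zero => exact i.elim0
  | succ n ih =>
    have mixed : ∀ i : Fin n, X.T (X.act i.castSucc) ≫ X.act (Fin.last n) =
        X.s (n + 1) ≫ X.T (X.act (Fin.last n)) ≫ X.act i.castSucc := by
      intro i
      rw [act_last, act_castSucc, X.T_comp, X.assoc, X.m_nat, X.reassoc (X.Tm_s n), X.assoc,
        X.assoc, X.reassoc (X.s_s (n + 1)), X.id_comp]
    induction i using Fin.lastCases with
    | last =>
      induction j using Fin.lastCases with
      | last => rw [act_last, X.m_assoc, X.reassoc (X.s_m (n + 1))]
      | cast j => rw [mixed, X.reassoc (X.s_s (n + 1)), X.id_comp]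
    | cast i =>
      induction j using Fin.lastCases with
      | last => exact mixed i
      | cast j =>
        have key := congrArg X.T (ih i j)
        simp only [X.T_comp] at key
        simp only [act_castSucc, X.T_comp, X.assoc]
        rw [X.reassoc (X.s_nat _), X.reassoc (X.s_nat (X.act j)), X.assoc, X.assoc, key,
          X.reassoc₃ (X.yang_baxter n), X.assoc, X.assoc]

/-- The mirror image of `act_act`, from coassociativity, cocommutativity and Yang–Baxter. -/
theorem coact_coact {n : ℕ} (i j : Fin n) :
    X.coact i ≫ X.T (X.coact j) = X.coact j ≫ X.T (X.coact i) ≫ X.s n := by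
  induction n with
  | zero => exact i.elim0
  | succ n ih =>
    have mixed : ∀ i : Fin n, X.coact (Fin.last n) ≫ X.T (X.coact i.castSucc) =
        X.coact i.castSucc ≫ X.T (X.coact (Fin.last n)) ≫ X.s (n + 1) := by
      intro i
      simp only [coact_last, coact_castSucc, X.T_comp, X.assoc]
      rw [X.reassoc (X.d_nat (X.coact i)).symm, X.assoc, X.reassoc (X.s_Td n), X.assoc,
        X.assoc, X.s_s (n + 1), X.comp_id]
    induction i using Fin.lastCases with
    | last =>
      induction j using Fin.lastCases with
      | last => rw [coact_last, X.reassoc (X.d_coassoc n), X.assoc, X.d_s, X.d_coassoc]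
      | cast j => exact mixed j
    | cast i =>
      induction j using Fin.lastCases with
      | last =>
        rw [X.reassoc (mixed i), X.assoc, X.assoc, X.s_s, X.comp_id]
      | cast j =>
        have key := congrArg X.T (ih i j)
        simp only [X.T_comp] at key
        simp only [coact_castSucc, X.T_comp, X.assoc]
        rw [X.reassoc (X.s_nat (X.coact j)).symm, X.reassoc (X.s_nat (X.coact i)).symm, X.assoc, X.assoc,
          X.reassoc key, X.assoc, X.assoc, X.yang_baxter n]

/-- This moves copies in front of merges. The Frobenius law enters, with commutativity, only when
both wires are the last one; the other cases are naturality and Yang–Baxter. -/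
theorem act_coact {n : ℕ} (j k : Fin n) :
    X.act j ≫ X.coact k = X.T (X.coact k) ≫ X.s n ≫ X.T (X.act j) := by
  induction n with
  | zero => exact j.elim0
  | succ n ih =>
    induction j using Fin.lastCases with
    | last =>
      induction k using Fin.lastCases with
      | last =>
        rw [act_last, coact_last, ← X.reassoc (X.s_m n), ← X.frobenius_right,
          X.reassoc (X.s_d n), X.assoc, X.assoc, ← X.T_comp, X.s_m]
      | cast k =>
        rw [act_last, coact_castSucc, X.T_comp, X.assoc, ← X.m_s, X.reassoc (X.m_nat _).symm,
          X.assoc]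
    | cast j =>
      induction k using Fin.lastCases with
      | last =>
        simp only [act_castSucc, coact_last, X.T_comp, X.assoc]
        rw [X.d_nat, X.reassoc (X.s_d n), X.assoc, X.assoc]
      | cast k =>
        have key := congrArg X.T (ih j k)
        simp only [X.T_comp] at key
        simp only [act_castSucc, coact_castSucc, X.T_comp, X.assoc]
        rw [X.reassoc key, X.assoc, X.assoc, X.s_nat, X.reassoc₃ (X.yang_baxter n), X.assoc,
          X.assoc, X.reassoc (X.s_nat _), X.assoc]

/-- The Frobenius law at an arbitrary wire: the copy may be taken from the extra wire before it is
merged, since both end up connected. -/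
theorem act_coact_self {n : ℕ} (j : Fin n) :
    X.act j ≫ X.coact j = X.d n ≫ X.T (X.act j) := by
  induction n with
  | zero => exact j.elim0
  | succ n ih =>
    induction j using Fin.lastCases with
    | last => rw [act_last, coact_last, X.frobenius_right]
    | cast j =>
      have key := congrArg X.T (ih j)
      simp only [X.T_comp] at key
      simp only [act_castSucc, coact_castSucc, X.T_comp, X.assoc]
      rw [X.reassoc key, X.assoc, X.s_nat, X.reassoc (X.s_Td n), X.assoc, X.assoc,
        X.reassoc (X.s_s (n + 1)), X.id_comp]

theorem coact_d {n : ℕ} (j : Fin n) :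
    X.coact j ≫ X.d n = X.coact j ≫ X.T (X.coact j) := by
  induction n with
  | zero => exact j.elim0
  | succ n ih =>
    induction j using Fin.lastCases with
    | last => rw [coact_last, X.d_coassoc]
    | cast j =>
      have key := congrArg X.T (ih j)
      simp only [X.T_comp] at key
      simp only [coact_castSucc, X.T_comp, X.assoc]
      rw [X.s_d, X.reassoc key, X.assoc, X.reassoc (X.s_nat _).symm, X.assoc]

/-- Both sides connect the last wire to `j`, with the copy taken at opposite ends. For `j` last they
are the two Frobenius forms of `m ≫ d`. This is what makes links symmetric. -/
theorem d_act {n : ℕ} (j : Fin n) : X.d n ≫ X.T (X.act j) = X.T (X.coact j) ≫ X.m n := by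
  induction n with
  | zero => exact j.elim0
  | succ n ih =>
    induction j using Fin.lastCases with
    | last => rw [act_last, coact_last, X.frobenius_left, X.frobenius_right]
    | cast j =>
      have key := congrArg X.T (ih j)
      simp only [X.T_comp] at key
      simp only [act_castSucc, coact_castSucc, X.T_comp, X.assoc]
      have h : X.T (X.s n) ≫ X.m (n + 1) = X.s (n + 1) ≫ X.T (X.m n) ≫ X.s n := by
        rw [X.Tm_s, X.reassoc (X.s_s (n + 1)), X.id_comp]
      have h' : X.d (n + 1) ≫ X.T (X.s n) = X.s n ≫ X.T (X.d n) ≫ X.s (n + 1) := by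
        rw [X.reassoc (X.s_Td n), X.assoc, X.assoc, X.s_s, X.comp_id]
      rw [h, X.reassoc h', X.assoc, X.assoc, ← X.s_nat, X.reassoc key, X.assoc,
        X.reassoc (X.s_nat _).symm, X.assoc]

/-- Connect the wires `i` and `j`. -/
def link {n : ℕ} (i j : Fin n) : X.Hom n n := X.coact i ≫ X.act j

/-- The special law, carried to an arbitrary wire. -/
theorem link_self {n : ℕ} (i : Fin n) : X.link i i = X.id n := by
  unfold link
  induction n with
  | zero => exact i.elim0
  | succ n ih =>
    induction i using Fin.lastCases with
    | last => rw [act_last, coact_last, X.d_m]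
    | cast i =>
      rw [act_castSucc, coact_castSucc, X.assoc, X.reassoc (X.s_s n), X.id_comp, ← X.T_comp, ih,
        X.T_id]

theorem link_castSucc {n : ℕ} (i j : Fin n) :
    X.link i.castSucc j.castSucc = X.T (X.link i j) := by
  unfold link
  rw [act_castSucc, coact_castSucc, X.assoc, X.reassoc (X.s_s n), X.id_comp, X.T_comp]

theorem link_last_castSucc {n : ℕ} (j : Fin n) :
    X.link (Fin.last n) j.castSucc = X.d n ≫ X.T (X.act j) := by
  rw [link, act_castSucc, coact_last, X.reassoc (X.d_s n)]

theorem link_castSucc_last {n : ℕ} (j : Fin n) :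
    X.link j.castSucc (Fin.last n) = X.T (X.coact j) ≫ X.m n := by
  rw [link, act_last, coact_castSucc, X.assoc, X.s_m]

theorem link_symm {n : ℕ} (i j : Fin n) : X.link i j = X.link j i := by
  induction n with
  | zero => exact i.elim0
  | succ n ih =>
    induction i using Fin.lastCases with
    | last =>
      induction j using Fin.lastCases with
      | last => rfl
      | cast j => rw [link_last_castSucc, link_castSucc_last, X.d_act]
    | cast i =>
      induction j using Fin.lastCases with
      | last => rw [link_last_castSucc, link_castSucc_last, X.d_act]
      | cast j => rw [link_castSucc, link_castSucc, ih]

/-- By `act_coact` both products become two copies followed by two merges, and these may be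
reordered by `coact_coact` and `act_act`; the two crossings that appear cancel. -/
theorem link_comm {n : ℕ} (i j k l : Fin n) :
    X.link i j ≫ X.link k l = X.link k l ≫ X.link i j := by
  simp only [link, X.assoc]
  rw [X.reassoc (X.act_coact j k), X.reassoc (X.act_coact l i)]
  simp only [X.assoc]
  rw [X.act_act j l, X.reassoc (X.s_s n), X.id_comp, X.reassoc (X.coact_coact i k), X.assoc,
    X.assoc]

/-- Once `i` and `j` are connected, a further copy may be taken from either. Both sides reduce to
copying `i`, copying that copy, and merging one into `j` and the other into `k`. -/
theorem link_trans {n : ℕ} (i j k : Fin n) :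
    X.link i j ≫ X.link j k = X.link i j ≫ X.link i k := by
  simp only [link, X.assoc]
  rw [X.reassoc (X.act_coact_self j), X.reassoc (X.act_coact j i)]
  simp only [X.assoc]
  rw [X.reassoc (X.coact_d i).symm, X.assoc, X.reassoc (X.d_s n)]

theorem link_idem {n : ℕ} (i j : Fin n) : X.link i j ≫ X.link i j = X.link i j := by
  rw [← X.link_trans, X.link_self, X.comp_id]

end Tower

/-! ### Products of links, their transport along wire maps, and normal forms. -/

namespace Tower

local infixr:80 " ≫ " => Tower.comp _

variable (X : Tower)

/-- The extension of a map of finite sets to a new last element. -/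
def extend {a b : ℕ} (φ : Fin a → Fin b) : Fin (a + 1) → Fin (b + 1) :=
  Fin.lastCases (motive := fun _ => Fin (b + 1)) (Fin.last b) (fun j => (φ j).castSucc)

theorem extend_last {a b : ℕ} (φ : Fin a → Fin b) : extend φ (Fin.last a) = Fin.last b := by
  rw [extend, Fin.lastCases_last]

theorem extend_castSucc {a b : ℕ} (φ : Fin a → Fin b) (j : Fin a) :
    extend φ j.castSucc = (φ j).castSucc := by
  rw [extend, Fin.lastCases_castSucc]

/-- The morphism `f` intertwines the actions of the wires along `φ`. -/
structure Covers {a b : ℕ} (f : X.Hom a b) (φ : Fin a → Fin b) : Prop where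
  act : ∀ j, X.act j ≫ f = X.T f ≫ X.act (φ j)
  coact : ∀ j, X.coact j ≫ X.T f = f ≫ X.coact (φ j)

/-- The morphism `g` intertwines the actions of the wires backwards along `φ`. -/
structure Cocovers {a b : ℕ} (g : X.Hom b a) (φ : Fin a → Fin b) : Prop where
  act : ∀ j, X.act (φ j) ≫ g = X.T g ≫ X.act j
  coact : ∀ j, X.coact (φ j) ≫ X.T g = g ≫ X.coact j

variable {X}

theorem Covers.link {a b : ℕ} {f : X.Hom a b} {φ : Fin a → Fin b} (h : X.Covers f φ)
    (i j : Fin a) : X.link i j ≫ f = f ≫ X.link (φ i) (φ j) := by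
  rw [Tower.link, X.assoc, h.act, X.reassoc (h.coact i), X.assoc, Tower.link]

theorem Cocovers.link {a b : ℕ} {g : X.Hom b a} {φ : Fin a → Fin b} (h : X.Cocovers g φ)
    (i j : Fin a) : X.link (φ i) (φ j) ≫ g = g ≫ X.link i j := by
  rw [Tower.link, X.assoc, h.act, X.reassoc (h.coact i), X.assoc, Tower.link]

theorem Covers.id (n : ℕ) : X.Covers (X.id n) _root_.id :=
  ⟨fun _ => by rw [X.comp_id, X.T_id, X.id_comp]; rfl,
    fun _ => by rw [X.T_id, X.comp_id, X.id_comp]; rfl⟩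

theorem Covers.comp {a b c : ℕ} {f : X.Hom a b} {g : X.Hom b c} {φ : Fin a → Fin b}
    {ψ : Fin b → Fin c} (hf : X.Covers f φ) (hg : X.Covers g ψ) :
    X.Covers (f ≫ g) (ψ ∘ φ) :=
  ⟨fun j => by rw [X.reassoc (hf.act j), X.assoc, hg.act, X.T_comp, X.assoc]; rfl,
    fun j => by rw [X.T_comp, X.reassoc (hf.coact j), X.assoc, hg.coact, X.assoc]; rfl⟩

theorem Covers.T {a b : ℕ} {f : X.Hom a b} {φ : Fin a → Fin b} (h : X.Covers f φ) :
    X.Covers (X.T f) (extend φ) := by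
  constructor <;> intro j <;> induction j using Fin.lastCases with
  | last => simp only [extend_last, act_last, coact_last, X.m_nat, X.d_nat]
  | cast j =>
    have k₁ := congrArg X.T (h.act j)
    have k₂ := congrArg X.T (h.coact j)
    simp only [X.T_comp] at k₁ k₂
    simp only [extend_castSucc, act_castSucc, coact_castSucc, X.assoc]
    first
    | rw [k₁, X.reassoc (X.s_nat f), X.assoc]
    | rw [← X.s_nat, X.reassoc k₂, X.assoc]

theorem Cocovers.T {a b : ℕ} {g : X.Hom b a} {φ : Fin a → Fin b} (h : X.Cocovers g φ) :
    X.Cocovers (X.T g) (extend φ) := by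
  constructor <;> intro j <;> induction j using Fin.lastCases with
  | last => simp only [extend_last, act_last, coact_last, X.m_nat, X.d_nat]
  | cast j =>
    have k₁ := congrArg X.T (h.act j)
    have k₂ := congrArg X.T (h.coact j)
    simp only [X.T_comp] at k₁ k₂
    simp only [extend_castSucc, act_castSucc, coact_castSucc, X.assoc]
    first
    | rw [k₁, X.reassoc (X.s_nat g), X.assoc]
    | rw [← X.s_nat, X.reassoc k₂, X.assoc]

variable (X)

theorem covers_u (n : ℕ) : X.Covers (X.u n) Fin.castSucc := by
  constructor <;> intro j
  · rw [act_castSucc, X.reassoc (X.Tu_s n), X.u_nat]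
  · rw [coact_castSucc, X.reassoc (X.u_nat _).symm, X.assoc, X.u_s]

/-- The discarded wire has no image, so links are transported backwards, along the inclusion of the
wires that are kept. -/
theorem cocovers_e (n : ℕ) : X.Cocovers (X.e n) Fin.castSucc := by
  constructor <;> intro j
  · rw [act_castSucc, X.assoc, X.e_nat, X.reassoc (X.s_e n)]
  · rw [coact_castSucc, X.assoc, X.s_Te, X.e_nat]

/-- The transposition of the last two elements. -/
def swapLast (n : ℕ) : Fin (n + 1 + 1) → Fin (n + 1 + 1) :=
  Fin.lastCases (motive := fun _ => Fin (n + 1 + 1)) (Fin.last n).castSucc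
    (Fin.lastCases (motive := fun _ => Fin (n + 1 + 1)) (Fin.last (n + 1))
      (fun j => j.castSucc.castSucc))

theorem swapLast_last (n : ℕ) : swapLast n (Fin.last (n + 1)) = (Fin.last n).castSucc := by
  rw [swapLast, Fin.lastCases_last]

theorem swapLast_castSucc_last (n : ℕ) :
    swapLast n (Fin.last n).castSucc = Fin.last (n + 1) := by
  rw [swapLast, Fin.lastCases_castSucc, Fin.lastCases_last]

theorem swapLast_castSucc_castSucc (n : ℕ) (j : Fin n) :
    swapLast n j.castSucc.castSucc = j.castSucc.castSucc := by
  rw [swapLast, Fin.lastCases_castSucc, Fin.lastCases_castSucc]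

theorem covers_s (n : ℕ) : X.Covers (X.s n) (swapLast n) := by
  constructor <;> intro j <;> induction j using Fin.lastCases with
  | last =>
    simp only [swapLast_last, act_last, coact_last, act_castSucc, coact_castSucc]
    first
    | exact X.m_s n
    | rw [X.reassoc (X.s_Td n), X.assoc, X.assoc, X.s_s, X.comp_id]
  | cast j =>
    induction j using Fin.lastCases with
    | last =>
      simp only [swapLast_castSucc_last, act_last, coact_last, act_castSucc, coact_castSucc,
        X.assoc]
      first
      | rw [X.Tm_s, X.reassoc (X.s_s (n + 1)), X.id_comp]
      | rw [X.s_d]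
    | cast j =>
      simp only [swapLast_castSucc_castSucc, act_castSucc, coact_castSucc, X.T_comp, X.assoc]
      first
      | rw [X.s_nat, X.reassoc₃ (X.yang_baxter n), X.assoc, X.assoc]
      | rw [X.yang_baxter, X.reassoc (X.s_nat _), X.assoc]

/-- Connect all pairs of wires in a list. -/
def links {n : ℕ} : List (Fin n × Fin n) → X.Hom n n
  | [] => X.id n
  | p :: l => X.link p.1 p.2 ≫ links l

/-- The equivalence relation generated by a list of pairs. -/
def Connected {n : ℕ} (l : List (Fin n × Fin n)) : Fin n → Fin n → Prop :=
  Relation.EqvGen fun i j => (i, j) ∈ l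

theorem links_append {n : ℕ} (l l' : List (Fin n × Fin n)) :
    X.links (l ++ l') = X.links l ≫ X.links l' := by
  induction l with
  | nil => exact (X.id_comp _).symm
  | cons p l ih => rw [List.cons_append, links, links, X.assoc, ih]

/-- This recovers the multiplication and the comultiplication from a link together with a counit or
a unit. -/
theorem link_castSucc_last_last (n : ℕ) :
    X.link (Fin.last n).castSucc (Fin.last (n + 1)) = X.m n ≫ X.d n := by
  rw [link_castSucc_last, coact_last, X.frobenius_left]

theorem links_link {n : ℕ} (l : List (Fin n × Fin n)) (i j : Fin n) :
    X.links l ≫ X.link i j = X.link i j ≫ X.links l := by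
  induction l with
  | nil => rw [links, X.id_comp, X.comp_id]
  | cons p l ih => rw [links, X.assoc, ih, X.reassoc (X.link_comm _ _ _ _), X.assoc]

theorem links_comm {n : ℕ} (l l' : List (Fin n × Fin n)) :
    X.links l ≫ X.links l' = X.links l' ≫ X.links l := by
  induction l' with
  | nil => rw [links, X.id_comp, X.comp_id]
  | cons p l' ih => rw [links, X.reassoc (X.links_link l _ _), X.assoc, ih, X.assoc]

/-- Idempotence absorbs a listed pair, and `link_self`, `link_symm` and `link_trans` carry
absorption through the steps that generate an equivalence relation. -/
theorem links_absorb_link {n : ℕ} {l : List (Fin n × Fin n)} {i j : Fin n}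
    (h : Connected l i j) : X.links l ≫ X.link i j = X.links l := by
  induction h with
  | rel i j h =>
    induction l with
    | nil => cases h
    | cons p l ih =>
      rw [links, X.assoc]
      rcases List.mem_cons.1 h with rfl | h
      · rw [links_link, X.reassoc (X.link_idem _ _)]
      · rw [ih h]
  | refl i => rw [X.link_self, X.comp_id]
  | symm i j _ ih => rw [X.link_symm, ih]
  | trans i j k _ _ ih ih' =>
    rw [← ih, X.assoc, ← X.link_trans, ← X.assoc, ih, ih']

theorem links_absorb {n : ℕ} {l l' : List (Fin n × Fin n)}
    (h : ∀ p ∈ l', Connected l p.1 p.2) : X.links l ≫ X.links l' = X.links l := by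
  induction l' with
  | nil => rw [links, X.comp_id]
  | cons p l' ih =>
    rw [links, X.reassoc (X.links_absorb_link (h p (by simp))), ih fun q hq => h q (by simp [hq])]

/-- Each product absorbs the other, and they commute, so both equal their common product. -/
theorem links_eq {n : ℕ} {l l' : List (Fin n × Fin n)} (h : ∀ p ∈ l', Connected l p.1 p.2)
    (h' : ∀ p ∈ l, Connected l' p.1 p.2) : X.links l = X.links l' := by
  rw [← X.links_absorb h, X.links_comm, X.links_absorb h']

variable {X} in
theorem Covers.links {a b : ℕ} {f : X.Hom a b} {φ : Fin a → Fin b} (h : X.Covers f φ)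
    (l : List (Fin a × Fin a)) :
    X.links l ≫ f = f ≫ X.links (l.map (Prod.map φ φ)) := by
  induction l with
  | nil => rw [List.map_nil, Tower.links, Tower.links, X.id_comp, X.comp_id]
  | cons p l ih =>
    rw [List.map_cons, Tower.links, Tower.links, X.assoc, ih, X.reassoc (h.link _ _), X.assoc]
    rfl

variable {X} in
theorem Cocovers.links {a b : ℕ} {g : X.Hom b a} {φ : Fin a → Fin b} (h : X.Cocovers g φ)
    (l : List (Fin a × Fin a)) :
    X.links (l.map (Prod.map φ φ)) ≫ g = g ≫ X.links l := by
  induction l with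
  | nil => rw [List.map_nil, Tower.links, Tower.links, X.id_comp, X.comp_id]
  | cons p l ih =>
    rw [List.map_cons, Tower.links, Tower.links, X.assoc, ih]
    exact (X.reassoc (h.link _ _) _).trans (X.assoc _ _ _)

/-- A fresh wire that is attached to an existing one and then discarded leaves no trace, by the unit
and counit laws. -/
theorem u_link_e {n : ℕ} (i : Fin n) :
    X.u n ≫ X.link i.castSucc (Fin.last n) ≫ X.e n = X.id n := by
  have act_e : X.T (X.coact i) ≫ X.m n ≫ X.e n = X.act i := by
    rw [← X.assoc, ← X.d_act, X.assoc, X.e_nat, X.reassoc (X.d_e n), X.id_comp]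
  have u_act : ∀ {n : ℕ} (i : Fin n), X.u n ≫ X.act i = X.id n := by
    intro n i
    induction n with
    | zero => exact i.elim0
    | succ n ih =>
      induction i using Fin.lastCases with
      | last => rw [act_last, X.u_m]
      | cast i => rw [act_castSucc, X.reassoc (X.u_s n), ← X.T_comp, ih, X.T_id]
  rw [link_castSucc_last, X.assoc, act_e, u_act]

/-- Elimination of an internal wire: what remains is the generated equivalence relation restricted
to the other wires. -/
theorem exists_u_links_e {n : ℕ} (l : List (Fin (n + 1) × Fin (n + 1))) :
    ∃ l', X.u n ≫ X.links l ≫ X.e n = X.links l' := by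
  classical
  -- All pairs of remaining wires that `l` connects, including those connected only through the last
  -- wire.
  let l' := (Finset.univ.filter fun p : Fin n × Fin n =>
    Connected l p.1.castSucc p.2.castSucc).toList
  have mem : ∀ p, p ∈ l' ↔ Connected l p.1.castSucc p.2.castSucc := by simp [l']
  have up : ∀ p ∈ l'.map (Prod.map Fin.castSucc Fin.castSucc), Connected l p.1 p.2 := by
    intro p hp
    obtain ⟨q, hq, rfl⟩ := List.mem_map.1 hp
    exact (mem q).1 hq
  refine ⟨l', ?_⟩
  by_cases h : ∃ i : Fin n, Connected l i.castSucc (Fin.last n)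
  · obtain ⟨i, hi⟩ := h
    have key : X.links l = X.links ((i.castSucc, Fin.last n) ::
        l'.map (Prod.map Fin.castSucc Fin.castSucc)) := by
      refine X.links_eq ?_ ?_
      · intro p hp
        rcases List.mem_cons.1 hp with rfl | hp
        · exact hi
        · exact up p hp
      -- Every wire has a representative other than the last wire, connected to it by both lists:
      -- `i` represents the last wire, and any other wire represents itself.
      · have main : ∀ a, ∃ b : Fin n, Connected l a b.castSucc ∧
            Connected ((i.castSucc, Fin.last n) ::
              l'.map (Prod.map Fin.castSucc Fin.castSucc)) a b.castSucc := by
          intro a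
          induction a using Fin.lastCases with
          | last => exact ⟨i, hi.symm, (Relation.EqvGen.rel _ _ (by simp)).symm⟩
          | cast a => exact ⟨a, .refl _, .refl _⟩
        intro p hp
        obtain ⟨a, ha, ha'⟩ := main p.1
        obtain ⟨b, hb, hb'⟩ := main p.2
        refine (ha'.trans _ _ _ (.rel _ _ (List.mem_cons_of_mem _ (List.mem_map.2
          ⟨(a, b), (mem _).2 ?_, rfl⟩)))).trans _ _ _ hb'.symm
        exact (ha.symm.trans _ _ _ (.rel _ _ hp)).trans _ _ _ hb
    rw [key, links, X.assoc, (X.cocovers_e n).links, ← X.assoc (X.link _ _), ← X.assoc,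
      u_link_e, X.id_comp]
  -- Here the last wire is connected to nothing else, so after `links` has been moved past `e` what
  -- remains is `u ≫ e`, which the extra law removes.
  · have key : X.links l = X.links (l'.map (Prod.map Fin.castSucc Fin.castSucc)) := by
      refine X.links_eq up ?_
      rintro ⟨a, b⟩ hp
      have hp' : Connected l a b := .rel _ _ hp
      dsimp only
      induction a using Fin.lastCases with
      | last =>
        induction b using Fin.lastCases with
        | last => exact .refl _
        | cast b => exact absurd ⟨b, hp'.symm⟩ h
      | cast a =>
        induction b using Fin.lastCases with
        | last => exact absurd ⟨a, hp'⟩ h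
        | cast b => exact .rel _ _ (List.mem_map.2 ⟨(a, b), (mem _).2 hp', rfl⟩)
    rw [key, (X.cocovers_e n).links, X.reassoc (X.u_e n), X.id_comp]

/-- Adjoin `k` unit wires. -/
def units (m : ℕ) : ∀ k : ℕ, X.Hom m (m + k)
  | 0 => X.id m
  | k + 1 => units m k ≫ X.u (m + k)

/-- Discard all wires. -/
def discardAll : ∀ m : ℕ, X.Hom m 0
  | 0 => X.id 0
  | m + 1 => X.e m ≫ discardAll m

/-- Discard the first `m` wires. -/
def discard (m : ℕ) : ∀ n : ℕ, X.Hom (m + n) n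
  | 0 => X.discardAll m
  | n + 1 => X.T (discard m n)

/-- The morphism given by a list of identifications between input and output wires. -/
def normal (m n : ℕ) (l : List (Fin (m + n) × Fin (m + n))) : X.Hom m n :=
  X.units m n ≫ X.links l ≫ X.discard m n

theorem cocovers_discard (m n : ℕ) : X.Cocovers (X.discard m n) (Fin.natAdd m) := by
  induction n with
  | zero => exact ⟨fun j => j.elim0, fun j => j.elim0⟩
  | succ n ih =>
    have : (Fin.natAdd m : Fin (n + 1) → Fin (m + (n + 1))) = extend (Fin.natAdd m) := by
      funext j
      induction j using Fin.lastCases with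
      | last => rw [extend_last]; rfl
      | cast j => rw [extend_castSucc]; rfl
    rw [this]
    exact ih.T

/-- Symmetries of adjacent wires. -/
inductive IsSwap : ∀ {a b : ℕ}, X.Hom a b → Prop
  | s (n : ℕ) : IsSwap (X.s n)
  | T {a b : ℕ} {f : X.Hom a b} (h : IsSwap f) : IsSwap (X.T f)

/-- Morphisms built from the elementary operations that keep normal forms normal. -/
inductive IsElementary : ∀ {a b : ℕ}, X.Hom a b → Prop
  | id (n : ℕ) : IsElementary (X.id n)
  | u (n : ℕ) : IsElementary (X.u n)
  | e (n : ℕ) : IsElementary (X.e n)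
  | link {n : ℕ} (i j : Fin n) : IsElementary (X.link i j)
  | swap {a b : ℕ} {f : X.Hom a b} (h : X.IsSwap f) : IsElementary f
  | comp {a b c : ℕ} {f : X.Hom a b} {g : X.Hom b c} (hf : IsElementary f)
      (hg : IsElementary g) : IsElementary (f ≫ g)

/-- Morphisms built from the Frobenius structure. -/
inductive IsGenerated : ∀ {a b : ℕ}, X.Hom a b → Prop
  | id (n : ℕ) : IsGenerated (X.id n)
  | m (n : ℕ) : IsGenerated (X.m n)
  | u (n : ℕ) : IsGenerated (X.u n)
  | d (n : ℕ) : IsGenerated (X.d n)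
  | e (n : ℕ) : IsGenerated (X.e n)
  | s (n : ℕ) : IsGenerated (X.s n)
  | T {a b : ℕ} {f : X.Hom a b} (h : IsGenerated f) : IsGenerated (X.T f)
  | comp {a b c : ℕ} {f : X.Hom a b} {g : X.Hom b c} (hf : IsGenerated f)
      (hg : IsGenerated g) : IsGenerated (f ≫ g)

variable {X}

/-- A unit or counit in the position before the last is one at the end composed with a crossing, so
`T` need not be a constructor of `IsElementary`. -/
theorem IsElementary.T {a b : ℕ} {f : X.Hom a b} (h : X.IsElementary f) :
    X.IsElementary (X.T f) := by
  induction h with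
  | id n => rw [X.T_id]; exact .id _
  | u n => rw [← X.u_s]; exact (IsElementary.u _).comp (.swap (.s n))
  | e n => rw [← X.s_e]; exact (IsElementary.swap (.s n)).comp (.e _)
  | link i j => rw [← X.link_castSucc]; exact .link _ _
  | swap h => exact .swap h.T
  | comp _ _ ih ih' => rw [X.T_comp]; exact ih.comp ih'

theorem IsGenerated.isElementary {a b : ℕ} {f : X.Hom a b} (h : X.IsGenerated f) :
    X.IsElementary f := by
  induction h with
  | id n => exact .id n
  | m n =>
    have : X.m n = X.link (Fin.last n).castSucc (Fin.last (n + 1)) ≫ X.e (n + 1) := by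
      rw [link_castSucc_last_last, X.assoc, X.d_e, X.comp_id]
    rw [this]
    exact (IsElementary.link _ _).comp (.e _)
  | u n => exact .u n
  | d n =>
    have : X.d n = X.u (n + 1) ≫ X.link (Fin.last n).castSucc (Fin.last (n + 1)) := by
      rw [link_castSucc_last_last, X.reassoc (X.u_m n), X.id_comp]
    rw [this]
    exact (IsElementary.u _).comp (.link _ _)
  | e n => exact .e n
  | s n => exact .swap (.s n)
  | T _ ih => exact ih.T
  | comp _ _ ih ih' => exact ih.comp ih'

/-- A crossing of outputs can be performed before the inputs are discarded. Acting on fresh unit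
wires, it is then absorbed by `units`; its only effect is to rename wires in the list. -/
theorem IsSwap.lift {a b : ℕ} {f : X.Hom a b} (h : X.IsSwap f) (m : ℕ) :
    ∃ f' : X.Hom (m + a) (m + b), X.discard m a ≫ f = f' ≫ X.discard m b ∧
      X.units m a ≫ f' = X.units m b ∧ ∃ φ, X.Covers f' φ := by
  induction h with
  | s n =>
    refine ⟨X.s (m + n), X.s_nat _, ?_, _, X.covers_s _⟩
    change (((X.units m n ≫ X.u (m + n)) ≫ X.u (m + n + 1)) ≫ X.s (m + n)) = _
    rw [X.assoc, X.u_s, X.assoc, ← X.u_nat, ← X.assoc]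
    rfl
  | T _ ih =>
    obtain ⟨f', h₁, h₂, φ, h₃⟩ := ih
    refine ⟨X.T f', ?_, ?_, _, h₃.T⟩
    · exact (X.T_comp _ _).symm.trans ((congrArg X.T h₁).trans (X.T_comp _ _))
    · rw [units, units, X.assoc, ← X.u_nat, X.reassoc h₂]
      rfl

/-- A new unit wire is added without links, a link adds a pair, and a crossing renames the pairs. A
discarded output becomes an internal wire, which is eliminated by `exists_u_links_e`. -/
theorem IsElementary.normal {a b : ℕ} {f : X.Hom a b} (h : X.IsElementary f) (m : ℕ)
    (l : List (Fin (m + a) × Fin (m + a))) :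
    ∃ l', X.normal m a l ≫ f = X.normal m b l' := by
  induction h with
  | id n => exact ⟨l, X.comp_id _⟩
  | u n =>
    refine ⟨l.map (Prod.map Fin.castSucc Fin.castSucc), ?_⟩
    rw [Tower.normal, Tower.normal, X.assoc, X.assoc, X.u_nat,
      X.reassoc ((X.covers_u (m + n)).links l), units, X.assoc, X.assoc]
    rfl
  | e n =>
    obtain ⟨l', h⟩ := X.exists_u_links_e (n := m + n) l
    refine ⟨l', ?_⟩
    rw [Tower.normal, Tower.normal, X.assoc, X.assoc, units, X.assoc]
    refine congrArg (X.comp _) ?_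
    rw [← h, X.assoc, X.assoc]
    exact congrArg (fun t => X.u (m + n) ≫ X.links l ≫ t) (X.e_nat _)
  | link i j =>
    refine ⟨l ++ [(Fin.natAdd m i, Fin.natAdd m j)], ?_⟩
    have : X.links [(Fin.natAdd m i, Fin.natAdd m j)] =
        X.link (Fin.natAdd m i) (Fin.natAdd m j) := X.comp_id _
    rw [Tower.normal, Tower.normal, links_append, this, X.assoc, X.assoc, X.assoc,
      (X.cocovers_discard _ _).link]
  | swap h =>
    obtain ⟨f', h₁, h₂, φ, h₃⟩ := h.lift m
    refine ⟨l.map (Prod.map φ φ), ?_⟩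
    rw [Tower.normal, Tower.normal, X.assoc, X.assoc, h₁, X.reassoc (h₃.links l), X.assoc,
      X.reassoc h₂]
  | comp _ _ ih ih' =>
    obtain ⟨l', h⟩ := ih l
    obtain ⟨l'', h'⟩ := ih' l'
    exact ⟨l'', by rw [← X.assoc, h, h']⟩

end Tower

/-! ### The identity as a normal form. -/

namespace Tower

local infixr:80 " ≫ " => Tower.comp _

variable (X : Tower)

/-- Move the wire at position `m` to the last position. -/
def rotate (m : ℕ) : ∀ k : ℕ, X.Hom (m + 1 + k) (m + k + 1)
  | 0 => X.id (m + 1)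
  | k + 1 => X.T (rotate m k) ≫ X.s (m + k)

theorem units_rotate (m k : ℕ) : X.units (m + 1) k ≫ X.rotate m k = X.T (X.units m k) := by
  induction k with
  | zero => rw [units, units, rotate, X.id_comp, X.T_id]
  | succ k ih =>
    rw [units, units, rotate, X.assoc, X.reassoc (X.u_nat (X.rotate m k)).symm, X.T_comp,
      X.assoc, X.u_s, X.reassoc ih]

/-- This separates the last input from the other discarded wires, as the induction on the number of
inputs requires. -/
theorem discard_succ (m k : ℕ) :
    X.discard (m + 1) k = X.rotate m k ≫ X.T (X.discard m k) ≫ X.e k := by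
  induction k with
  | zero =>
    rw [rotate, X.id_comp, X.e_nat]
    rfl
  | succ k ih =>
    change X.T (X.discard (m + 1) k) =
      (X.T (X.rotate m k) ≫ X.s (m + k)) ≫ X.T (X.T (X.discard m k)) ≫ X.e (k + 1)
    rw [ih, X.T_comp, X.T_comp, X.assoc, X.reassoc (X.s_nat _).symm, X.assoc, X.s_e]

theorem covers_rotate (m k : ℕ) : ∃ φ : Fin (m + 1 + k) → Fin (m + k + 1),
    X.Covers (X.rotate m k) φ ∧
    φ (Fin.castAdd k (Fin.last m)) = Fin.last (m + k) ∧
    (∀ i : Fin m, φ (Fin.castAdd k i.castSucc) = (Fin.castAdd k i).castSucc) ∧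
    ∀ j : Fin k, φ (Fin.natAdd (m + 1) j) = (Fin.natAdd m j).castSucc := by
  induction k with
  | zero => exact ⟨_, Covers.id _, rfl, fun _ => rfl, fun j => j.elim0⟩
  | succ k ih =>
    obtain ⟨φ, h, h₁, h₂, h₃⟩ := ih
    refine ⟨_, h.T.comp (X.covers_s _), ?_, fun i => ?_, fun j => ?_⟩
    · change swapLast _ (extend φ (Fin.castAdd k (Fin.last m)).castSucc) = _
      rw [extend_castSucc, h₁, swapLast_castSucc_last]
      rfl
    · change swapLast _ (extend φ (Fin.castAdd k i.castSucc).castSucc) = _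
      rw [extend_castSucc, h₂, swapLast_castSucc_castSucc]
      rfl
    · induction j using Fin.lastCases with
      | last =>
        change swapLast _ (extend φ (Fin.last _)) = _
        rw [extend_last, swapLast_last]
        rfl
      | cast j =>
        change swapLast _ (extend φ (Fin.natAdd (m + 1) j).castSucc) = _
        rw [extend_castSucc, h₃, swapLast_castSucc_castSucc]
        rfl

/-- The pairs that identify every input with the corresponding output. -/
def diagonal (m : ℕ) : List (Fin (m + m) × Fin (m + m)) :=
  (List.finRange m).map fun i => (Fin.castAdd m i, Fin.natAdd m i)

theorem links_map_castSucc {n : ℕ} (l : List (Fin n × Fin n)) :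
    X.links (l.map (Prod.map Fin.castSucc Fin.castSucc)) = X.T (X.links l) := by
  induction l with
  | nil => exact (X.T_id _).symm
  | cons p l ih =>
    rw [List.map_cons, links, links, X.T_comp, ih, ← X.link_castSucc]
    rfl

/-- The last input is rotated next to the last output. There the fresh wire, its link and the
discarded input compose to `u ≫ m ≫ d ≫ T e`, an identity wire; the remaining wires carry `T` of the
case `m`. -/
theorem normal_diagonal (m : ℕ) : X.normal m m (diagonal m) = X.id m := by
  induction m with
  | zero => simp [normal, diagonal, links, units, discard, discardAll, X.id_comp]
  | succ m ih =>
    obtain ⟨φ, h, h₁, h₂, h₃⟩ := X.covers_rotate m m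
    let D : List (Fin (m + 1 + m) × Fin (m + 1 + m)) :=
      (List.finRange m).map fun i => (Fin.castAdd m i.castSucc, Fin.natAdd (m + 1) i)
    have hD : diagonal (m + 1) = D.map (Prod.map Fin.castSucc Fin.castSucc) ++
        [((Fin.castAdd m (Fin.last m)).castSucc, Fin.last (m + 1 + m))] := by
      rw [diagonal, List.finRange_succ_last, List.map_append, List.map_map, List.map_map]
      rfl
    -- After the rotation the remaining pairs do not involve the last wire and form the diagonal of
    -- the smaller case.
    have hφ : D.map (Prod.map φ φ) = (diagonal m).map (Prod.map Fin.castSucc Fin.castSucc) := by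
      rw [diagonal, List.map_map, List.map_map]
      refine List.map_congr_left fun i _ => ?_
      exact Prod.ext (h₂ i) (h₃ i)
    have d_Te : X.d m ≫ X.T (X.e m) = X.id (m + 1) := by
      rw [← X.s_e, X.reassoc (X.d_s m), X.d_e]
    have hlink : ∀ {a b : ℕ} (f : X.Hom a b),
        X.link (Fin.last a).castSucc (Fin.last (a + 1)) ≫ X.T (X.T f) =
          X.T (X.T f) ≫ X.link (Fin.last b).castSucc (Fin.last (b + 1)) := by
      intro a b f
      rw [link_castSucc_last_last, link_castSucc_last_last, X.assoc, ← X.d_nat,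
        X.reassoc (X.m_nat f), X.assoc]
    -- The rotation takes the last input to the wire just below the last output, so its link becomes
    -- `m ≫ d`.
    have hrot := h.T.link (Fin.castAdd m (Fin.last m)).castSucc (Fin.last (m + 1 + m))
    rw [extend_castSucc, extend_last, h₁] at hrot
    have hl : X.links [((Fin.castAdd m (Fin.last m)).castSucc, Fin.last (m + 1 + m))] =
      X.link (Fin.castAdd m (Fin.last m)).castSucc (Fin.last (m + 1 + m)) := X.comp_id _
    change (X.units (m + 1) m ≫ X.u (m + 1 + m)) ≫ X.links (diagonal (m + 1)) ≫
      X.T (X.discard (m + 1) m) = _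
    rw [hD, links_append, hl, discard_succ, X.T_comp, X.T_comp, X.assoc, X.assoc,
      X.reassoc hrot, X.assoc, X.reassoc (hlink _), X.assoc,
      ← X.assoc (X.u _), ← (X.covers_u _).links, X.assoc, X.reassoc (X.u_nat _).symm,
      X.assoc, X.reassoc (X.u_nat (X.T (X.discard m m))).symm, X.assoc, link_castSucc_last_last,
      X.assoc, d_Te, X.comp_id, X.u_m, X.comp_id, X.reassoc (h.links D), X.assoc, hφ,
      links_map_castSucc, X.reassoc (X.units_rotate m m), ← X.T_comp, ← X.T_comp]
    exact (congrArg X.T ih).trans (X.T_id m)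

theorem IsGenerated.exists_normal {m n : ℕ} {f : X.Hom m n} (h : X.IsGenerated f) :
    ∃ l, f = X.normal m n l := by
  obtain ⟨l, h⟩ := h.isElementary.normal m (diagonal m)
  exact ⟨l, by rw [← h, normal_diagonal, X.id_comp]⟩

end Tower

/-! ### From a Frobenius monoid in a PROP to a tower. -/

namespace PROP

variable (P : PROP.{0})

local infixr:80 " ≫ " => PROPData.comp (PROP.toPROPData _)
local infixr:90 " ⊠ " => PROPData.tensor (PROP.toPROPData _)

theorem eqHom_comp_eqHom {a b c : ℕ} (h : a = b) (h' : b = c) :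
    P.eqHom h ≫ P.eqHom h' = P.eqHom (h.trans h') := by
  subst h h'
  exact P.id_comp _

theorem eqHom_comp_cancel {a b c : ℕ} (h : a = b) {f g : P.Hom b c}
    (hfg : P.eqHom h ≫ f = P.eqHom h ≫ g) : f = g := by
  subst h
  exact (P.id_comp f).symm.trans (hfg.trans (P.id_comp g))

theorem comp_tensor_id {a b c : ℕ} (f : P.Hom a b) (g : P.Hom b c) (n : ℕ) :
    (f ≫ g) ⊠ P.id n = (f ⊠ P.id n) ≫ (g ⊠ P.id n) := by
  rw [← P.interchange, P.id_comp]

theorem id_tensor_comp {a b c : ℕ} (f : P.Hom a b) (g : P.Hom b c) (n : ℕ) :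
    P.id n ⊠ (f ≫ g) = (P.id n ⊠ f) ≫ (P.id n ⊠ g) := by
  rw [← P.interchange, P.id_comp]

theorem tensor_eq {a b p q : ℕ} (f : P.Hom a b) (x : P.Hom p q) :
    f ⊠ x = (f ⊠ P.id p) ≫ (P.id b ⊠ x) := by
  rw [← P.interchange, P.id_comp, P.comp_id]

theorem tensor_slide {a b p q : ℕ} (f : P.Hom a b) (x : P.Hom p q) :
    (f ⊠ P.id p) ≫ (P.id b ⊠ x) = (P.id a ⊠ x) ≫ (f ⊠ P.id q) := by
  rw [← P.interchange, ← P.interchange, P.id_comp, P.comp_id, P.id_comp, P.comp_id]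

/-- Since `(a + p) + 1` and `a + (p + 1)` agree definitionally, both associators are identities. For
this reason towers adjoin wires on the right, one at a time. -/
theorem tensor_tensor_id_one {a b p q : ℕ} (f : P.Hom a b) (x : P.Hom p q) :
    (f ⊠ x) ⊠ P.id 1 = f ⊠ (x ⊠ P.id 1) :=
  (P.comp_id _).symm.trans ((P.tensor_assoc f x (P.id 1)).trans (P.id_comp _))

theorem tensor_id_succ {a b : ℕ} (f : P.Hom a b) (n : ℕ) :
    f ⊠ P.id (n + 1) = (f ⊠ P.id n) ⊠ P.id 1 := by
  rw [← P.tensor_id n 1]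
  exact (P.tensor_tensor_id_one f (P.id n)).symm

theorem tensor_id_zero {a b : ℕ} (f : P.Hom a b) : f ⊠ P.id 0 = f :=
  (P.comp_id _).symm.trans ((P.tensor_unit f).trans (P.id_comp _))

/-- The hexagon with two zero arguments gives `swap m 0 ≫ (id 0 ⊠ swap m 0) = swap m 0` up to casts.
Cancelling the invertible `swap m 0` leaves `id 0 ⊠ swap m 0`, which the unit law identifies with
`swap m 0` up to casts. -/
theorem swap_zero (m : ℕ) : P.swap m 0 = P.eqHom (Nat.zero_add m).symm := by
  have h : (P.swap m 0 ⊠ P.id 0) ≫ P.id (0 + m) ≫ (P.id 0 ⊠ P.swap m 0) =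
      P.id (m + 0) ≫ P.swap m 0 ≫ P.eqHom (Nat.add_assoc 0 0 m) := P.hexagon m 0 0
  rw [tensor_id_zero, P.id_comp (P.swap m 0 ≫ _)] at h
  replace h := h.symm.trans (congrArg (fun t => P.swap m 0 ≫ t) (P.id_comp _))
  have h' := congrArg (fun t => P.swap 0 m ≫ t) h
  simp only [← P.assoc, P.swap_swap, P.id_comp] at h'
  have h'' := P.unit_tensor (P.swap m 0)
  rw [← h', eqHom_comp_eqHom] at h''
  refine P.eqHom_comp_cancel (Nat.zero_add (m + 0)) (h''.symm.trans ?_)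
  rw [eqHom_comp_eqHom]

theorem swap_zero_left (m : ℕ) : P.swap 0 m = P.eqHom (Nat.zero_add m) := by
  have h := P.swap_swap m 0
  rw [swap_zero] at h
  refine P.eqHom_comp_cancel (Nat.zero_add m).symm (h.trans ?_)
  rw [eqHom_comp_eqHom]
  rfl

/-- The morphism `x` with `n` wires on its left. -/
abbrev left (n : ℕ) {a b : ℕ} (x : P.Hom a b) : P.Hom (n + a) (n + b) := P.id n ⊠ x

/-- The morphism `x` with one wire on its right. -/
abbrev right {a b : ℕ} (x : P.Hom a b) : P.Hom (a + 1) (b + 1) := x ⊠ P.id 1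

theorem hexagon_one_one : P.swap 1 2 = P.right (P.swap 1 1) ≫ P.left 1 (P.swap 1 1) := by
  have h : P.right (P.swap 1 1) ≫ P.id 3 ≫ P.left 1 (P.swap 1 1) =
    P.id 3 ≫ P.swap 1 2 ≫ P.id 3 := P.hexagon 1 1 1
  rw [P.id_comp, P.id_comp, P.comp_id] at h
  exact h.symm

/-- Inverting `hexagon_one_one` suffices, as `swap 2 1` is inverse to `swap 1 2`. -/
theorem swap_two_one : P.swap 2 1 = P.left 1 (P.swap 1 1) ≫ P.right (P.swap 1 1) := by
  have hl : P.left 1 (P.swap 1 1) ≫ P.left 1 (P.swap 1 1) = P.id 3 := by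
    rw [← id_tensor_comp, P.swap_swap, P.tensor_id]
  have hr : P.right (P.swap 1 1) ≫ P.right (P.swap 1 1) = P.id 3 := by
    rw [← comp_tensor_id, P.swap_swap, P.tensor_id]
  have h₁ : P.swap 1 2 ≫ (P.left 1 (P.swap 1 1) ≫ P.right (P.swap 1 1)) = P.id 3 := by
    rw [hexagon_one_one, P.assoc, ← P.assoc (P.left 1 (P.swap 1 1)), hl, P.id_comp, hr]
  have h₂ := congrArg (fun t => P.swap 2 1 ≫ t) h₁
  simp only [← P.assoc (P.swap 2 1), P.swap_swap 2 1] at h₂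
  exact (P.comp_id _).symm.trans (h₂.symm.trans (P.id_comp _))

/-- Naturality of `swap 1 2` with respect to `swap 1 1`, with `swap 1 2` expanded by the hexagon. -/
theorem yang_baxter :
    P.right (P.swap 1 1) ≫ P.left 1 (P.swap 1 1) ≫ P.right (P.swap 1 1) =
      P.left 1 (P.swap 1 1) ≫ P.right (P.swap 1 1) ≫ P.left 1 (P.swap 1 1) := by
  have h : P.left 1 (P.swap 1 1) ≫ P.swap 1 2 = P.swap 1 2 ≫ P.right (P.swap 1 1) :=
    P.swap_natural (P.id 1) (P.swap 1 1)
  rw [hexagon_one_one, P.assoc] at h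
  exact h.symm

theorem right_left (n : ℕ) {a b : ℕ} (x : P.Hom a b) :
    P.right (P.left n x) = P.left n (P.right x) :=
  P.tensor_tensor_id_one (P.id n) x

theorem left_left (j k : ℕ) {a b : ℕ} (x : P.Hom a b) :
    P.left (j + k) x ≫ P.eqHom (Nat.add_assoc j k b) =
      P.eqHom (Nat.add_assoc j k a) ≫ P.left j (P.left k x) := by
  have h := P.tensor_assoc (P.id j) (P.id k) x
  rw [P.tensor_id] at h
  exact h

/-- The arities of `swap 1 1` are numerals, so the casts of `left_left` are identities; the same
holds for the four generators below. -/
theorem left_add_swap (j k : ℕ) :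
    P.left (j + k) (P.swap 1 1) = P.left j (P.left k (P.swap 1 1)) :=
  (P.comp_id _).symm.trans ((P.left_left j k (P.swap 1 1)).trans (P.id_comp _))

theorem left_comp (n : ℕ) {a b c : ℕ} (f : P.Hom a b) (g : P.Hom b c) :
    P.left n (f ≫ g) = P.left n f ≫ P.left n g :=
  P.id_tensor_comp f g n

theorem left_zero_swap : P.left 0 (P.swap 1 1) = P.swap 1 1 :=
  (P.comp_id _).symm.trans ((P.unit_tensor _).trans (P.id_comp _))

theorem left_congr (n : ℕ) {a b c : ℕ} {f : P.Hom a b} {g : P.Hom b c} {k : P.Hom a c}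
    (h : f ≫ g = k) : P.left n f ≫ P.left n g = P.left n k := by
  rw [← id_tensor_comp, h]

theorem left_congr₂ (n : ℕ) {a b b' c : ℕ} {f : P.Hom a b} {g : P.Hom b c} {f' : P.Hom a b'}
    {g' : P.Hom b' c} (h : f ≫ g = f' ≫ g') :
    P.left n f ≫ P.left n g = P.left n f' ≫ P.left n g' := by
  rw [← id_tensor_comp, h, id_tensor_comp]

/-- An extraspecial commutative Frobenius monoid on the object `1` of a PROP. -/
structure ExtraSpecial where
  mul : P.Hom 2 1
  unit : P.Hom 0 1
  comul : P.Hom 1 2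
  counit : P.Hom 1 0
  mul_assoc : P.right mul ≫ mul = P.left 1 mul ≫ mul
  mul_unit : P.left 1 unit ≫ mul = P.id 1
  mul_comm : P.swap 1 1 ≫ mul = mul
  comul_coassoc : comul ≫ P.right comul = comul ≫ P.left 1 comul
  comul_counit : comul ≫ P.left 1 counit = P.id 1
  comul_comm : comul ≫ P.swap 1 1 = comul
  frobenius_left : P.right comul ≫ P.left 1 mul = mul ≫ comul
  frobenius_right : P.left 1 comul ≫ P.right mul = mul ≫ comul
  special : comul ≫ mul = P.id 1
  extra : unit ≫ counit = P.id 0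

namespace ExtraSpecial

variable {P}
variable (K : P.ExtraSpecial)

theorem left_add_mul (j k : ℕ) : P.left (j + k) K.mul = P.left j (P.left k K.mul) :=
  (P.comp_id _).symm.trans ((P.left_left j k K.mul).trans (P.id_comp _))

theorem left_add_unit (j k : ℕ) : P.left (j + k) K.unit = P.left j (P.left k K.unit) :=
  (P.comp_id _).symm.trans ((P.left_left j k K.unit).trans (P.id_comp _))

theorem left_add_comul (j k : ℕ) : P.left (j + k) K.comul = P.left j (P.left k K.comul) :=
  (P.comp_id _).symm.trans ((P.left_left j k K.comul).trans (P.id_comp _))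

theorem left_add_counit (j k : ℕ) : P.left (j + k) K.counit = P.left j (P.left k K.counit) :=
  (P.comp_id _).symm.trans ((P.left_left j k K.counit).trans (P.id_comp _))

theorem unit_swap : P.left 1 K.unit ≫ P.swap 1 1 = P.right K.unit := by
  have h := P.swap_natural (P.id 1) K.unit
  rw [swap_zero] at h
  exact h.trans (P.id_comp _)

theorem swap_counit : P.swap 1 1 ≫ P.left 1 K.counit = P.right K.counit := by
  have h := P.swap_natural K.counit (P.id 1)
  rw [swap_zero_left] at h
  exact h.symm.trans (P.comp_id _)

theorem mul_swap :
    P.right K.mul ≫ P.swap 1 1 =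
      P.left 1 (P.swap 1 1) ≫ P.right (P.swap 1 1) ≫ P.left 1 K.mul := by
  have h := P.swap_natural K.mul (P.id 1)
  rw [swap_two_one] at h
  exact h.trans (P.assoc _ _ _)

theorem swap_comul :
    P.swap 1 1 ≫ P.right K.comul =
      P.left 1 K.comul ≫ P.right (P.swap 1 1) ≫ P.left 1 (P.swap 1 1) := by
  have h := P.swap_natural (P.id 1) K.comul
  rw [hexagon_one_one] at h
  exact h.symm

/-- The tower of an extraspecial commutative Frobenius monoid. -/
def tower : Tower where
  Hom := P.Hom
  id := P.id
  comp := P.comp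
  T f := P.right f
  m n := P.left n K.mul
  u n := P.left n K.unit
  d n := P.left n K.comul
  e n := P.left n K.counit
  s n := P.left n (P.swap 1 1)
  id_comp := P.id_comp
  comp_id := P.comp_id
  assoc := P.assoc
  T_id n := P.tensor_id n 1
  T_comp f g := P.comp_tensor_id f g 1
  -- Naturality in the other wires is the interchange law, once `T (T f)` is read as `f ⊠ id 2`.
  m_nat f := (congrArg (fun t => t ≫ _) (P.tensor_id_succ f 1).symm).trans
    (P.tensor_slide f K.mul)
  u_nat f := (congrArg (fun t => t ≫ _) (P.tensor_id_zero f).symm).trans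
    (P.tensor_slide f K.unit)
  d_nat {a b} f := (P.tensor_slide f K.comul).trans
    (congrArg (fun t => P.left a K.comul ≫ t) (P.tensor_id_succ f 1))
  e_nat {a b} f := (P.tensor_slide f K.counit).trans
    (congrArg (fun t => P.left a K.counit ≫ t) (P.tensor_id_zero f))
  s_nat {a b} f := ((congrArg (fun t => t ≫ P.left b (P.swap 1 1))
    (P.tensor_id_succ f 1).symm).trans (P.tensor_slide f (P.swap 1 1))).trans
      (congrArg (fun t => P.left a (P.swap 1 1) ≫ t) (P.tensor_id_succ f 1))
  -- The remaining axioms are laws of `K` with `n` wires on the left: `right_left` turns `left n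
  -- (right x)` into `T (left n x)`, and the `left_add` lemmas turn `left n (left 1 x)` into `left
  -- (n + 1) x`.
  m_assoc n := by
    have h := P.left_congr₂ n K.mul_assoc
    rw [← right_left, ← K.left_add_mul] at h
    exact h
  u_m n := by
    have h := P.left_congr n K.mul_unit
    rw [← K.left_add_unit] at h
    exact h.trans (P.tensor_id n 1)
  s_m n := P.left_congr n K.mul_comm
  d_coassoc n := by
    have h := P.left_congr₂ n K.comul_coassoc
    rw [← right_left, ← K.left_add_comul] at h
    exact h
  d_e n := by
    have h := P.left_congr n K.comul_counit
    rw [← K.left_add_counit] at h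
    exact h.trans (P.tensor_id n 1)
  d_s n := P.left_congr n K.comul_comm
  frobenius_left n := by
    have h := P.left_congr₂ n K.frobenius_left
    rw [← right_left, ← K.left_add_mul] at h
    exact h
  frobenius_right n := by
    have h := P.left_congr₂ n K.frobenius_right
    rw [← right_left, ← K.left_add_comul] at h
    exact h
  d_m n := (P.left_congr n K.special).trans (P.tensor_id n 1)
  u_e n := (P.left_congr n K.extra).trans (P.tensor_id n 0)
  s_s n := (P.left_congr n (P.swap_swap 1 1)).trans (P.tensor_id n 2)
  yang_baxter n := by
    have h := P.left_congr₂ n P.yang_baxter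
    simp only [left_comp] at h
    rw [← right_left, ← left_add_swap] at h
    exact h
  Tm_s n := by
    have h := P.left_congr₂ n K.mul_swap
    simp only [left_comp] at h
    rw [← right_left, ← right_left, ← left_add_swap, ← K.left_add_mul] at h
    exact h
  s_Td n := by
    have h := P.left_congr₂ n K.swap_comul
    simp only [left_comp] at h
    rw [← right_left, ← right_left, ← left_add_swap, ← K.left_add_comul] at h
    exact h
  u_s n := by
    have h := P.left_congr n K.unit_swap
    rw [← right_left, ← K.left_add_unit] at h
    exact h
  s_e n := by
    have h := P.left_congr n K.swap_counit
    rw [← right_left, ← K.left_add_counit] at h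
    exact h

theorem isGenerated_eqHom {a b : ℕ} (h : a = b) : K.tower.IsGenerated (P.eqHom h) := by
  subst h
  exact .id _

theorem isGenerated_tensor_id {a b : ℕ} {f : P.Hom a b} (h : K.tower.IsGenerated f) (k : ℕ) :
    K.tower.IsGenerated (f ⊠ P.id k) := by
  induction k with
  | zero => rw [tensor_id_zero]; exact h
  | succ k ih => rw [tensor_id_succ]; exact ih.T

theorem isGenerated_id_tensor {a b : ℕ} {f : K.tower.Hom a b} (h : K.tower.IsGenerated f)
    (j : ℕ) : K.tower.IsGenerated (P.left j f) := by
  induction h with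
  | id n =>
    have h : P.left j (K.tower.id n) = K.tower.id (j + n) := P.tensor_id j n
    exact h ▸ Tower.IsGenerated.id (X := K.tower) (j + n)
  | m n => exact K.left_add_mul j n ▸ Tower.IsGenerated.m (X := K.tower) (j + n)
  | u n => exact K.left_add_unit j n ▸ Tower.IsGenerated.u (X := K.tower) (j + n)
  | d n => exact K.left_add_comul j n ▸ Tower.IsGenerated.d (X := K.tower) (j + n)
  | e n => exact K.left_add_counit j n ▸ Tower.IsGenerated.e (X := K.tower) (j + n)
  | s n => exact P.left_add_swap j n ▸ Tower.IsGenerated.s (X := K.tower) (j + n)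
  | T _ ih => exact P.right_left j _ ▸ ih.T
  | @comp a b c f g _ _ ih ih' =>
    have h : P.left j (K.tower.comp f g) = K.tower.comp (P.left j f) (P.left j g) :=
      P.left_comp j f g
    exact h ▸ ih.comp ih'

theorem isGenerated_tensor {a b c d : ℕ} {f : P.Hom a b} {g : P.Hom c d}
    (hf : K.tower.IsGenerated f) (hg : K.tower.IsGenerated g) :
    K.tower.IsGenerated (f ⊠ g) := by
  rw [tensor_eq]
  exact (K.isGenerated_tensor_id hf c).comp (K.isGenerated_id_tensor hg b)

theorem eq_eqHom_comp {a a' b b' : ℕ} (h : a = a') (h' : b' = b) {f : P.Hom a' b'}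
    {g : P.Hom a b} (hfg : P.eqHom h ≫ f ≫ P.eqHom h' = g) :
    f = P.eqHom h.symm ≫ g ≫ P.eqHom h'.symm := by
  subst h h' hfg
  change _ = P.id _ ≫ (P.id _ ≫ _ ≫ P.id _) ≫ P.id _
  simp only [P.id_comp, P.comp_id]

theorem swap_add (m n p : ℕ) :
    P.swap m (n + p) = P.eqHom (Nat.add_assoc m n p).symm ≫
      ((P.swap m n ⊠ P.id p) ≫ P.eqHom (Nat.add_assoc n m p) ≫ P.left n (P.swap m p)) ≫
      P.eqHom (Nat.add_assoc n p m).symm :=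
  eq_eqHom_comp _ _ (P.hexagon m n p).symm

/-- A generated morphism with a generated right inverse. -/
def HasInverse {a b : ℕ} (f : P.Hom a b) : Prop :=
  K.tower.IsGenerated f ∧ ∃ g : P.Hom b a, K.tower.IsGenerated g ∧ f ≫ g = P.id a

variable {K} in
theorem HasInverse.comp {a b c : ℕ} {f : P.Hom a b} {g : P.Hom b c} (hf : K.HasInverse f)
    (hg : K.HasInverse g) : K.HasInverse (f ≫ g) := by
  obtain ⟨hf, f', hf', h⟩ := hf
  obtain ⟨hg, g', hg', h'⟩ := hg
  refine ⟨hf.comp hg, g' ≫ f', hg'.comp hf', ?_⟩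
  rw [P.assoc, ← P.assoc g, h', P.id_comp, h]

theorem hasInverse_eqHom {a b : ℕ} (h : a = b) : K.HasInverse (P.eqHom h) :=
  ⟨K.isGenerated_eqHom h, P.eqHom h.symm, K.isGenerated_eqHom h.symm,
    P.eqHom_comp_eqHom h h.symm⟩

theorem isGenerated_swap_one_one : K.tower.IsGenerated (P.swap 1 1) := by
  have h : K.tower.IsGenerated (P.left 0 (P.swap 1 1)) := Tower.IsGenerated.s (X := K.tower) 0
  rw [left_zero_swap] at h
  exact h

/-- The hexagon splits only the second argument of a swap, so `swap m 1` is out of its reach. It is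
obtained as the inverse of `swap 1 m`, for which a generated inverse is recorded along the
induction. -/
theorem hasInverse_swap_one (n : ℕ) : K.HasInverse (P.swap 1 n) := by
  induction n with
  | zero => rw [swap_zero]; exact K.hasInverse_eqHom _
  | succ n ih =>
    rw [swap_add]
    refine (K.hasInverse_eqHom _).comp (HasInverse.comp (HasInverse.comp ?_
      ((K.hasInverse_eqHom _).comp ?_)) (K.hasInverse_eqHom _))
    · obtain ⟨h, g, hg, hfg⟩ := ih
      refine ⟨K.isGenerated_tensor_id h 1, g ⊠ P.id 1, K.isGenerated_tensor_id hg 1, ?_⟩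
      rw [← comp_tensor_id, hfg, P.tensor_id]
    · refine ⟨K.isGenerated_id_tensor K.isGenerated_swap_one_one n, P.left n (P.swap 1 1),
        K.isGenerated_id_tensor K.isGenerated_swap_one_one n, ?_⟩
      rw [← left_comp, P.swap_swap]
      exact P.tensor_id n 2

theorem isGenerated_swap (m n : ℕ) : K.tower.IsGenerated (P.swap m n) := by
  induction n with
  | zero => rw [swap_zero]; exact K.isGenerated_eqHom _
  | succ n ih =>
    have h : K.tower.IsGenerated (P.swap m 1) := by
      obtain ⟨-, g, hg, h⟩ := K.hasInverse_swap_one m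
      have h' : P.swap m 1 = g := by
        rw [← P.comp_id (P.swap m 1), ← h, ← P.assoc, P.swap_swap, P.id_comp]
      exact h' ▸ hg
    rw [swap_add]
    exact (K.isGenerated_eqHom _).comp (.comp (.comp (K.isGenerated_tensor_id ih 1)
      ((K.isGenerated_eqHom _).comp (K.isGenerated_id_tensor h n))) (K.isGenerated_eqHom _))

/-- The tower operations at `0` are `left 0 x`, which differs from `x` by the casts `0 + a = a`. -/
theorem isGenerated_of_left_zero {a b : ℕ} {f : P.Hom a b}
    (h : K.tower.IsGenerated (P.left 0 f)) : K.tower.IsGenerated f := by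
  have h' : f = P.eqHom (Nat.zero_add a).symm ≫ P.left 0 f ≫ P.eqHom (Nat.zero_add b) := by
    rw [left, P.unit_tensor, ← P.assoc, eqHom_comp_eqHom]
    exact (P.id_comp f).symm
  rw [h']
  exact (K.isGenerated_eqHom _).comp (h.comp (K.isGenerated_eqHom _))

end ExtraSpecial

end PROP

/-! ### Every morphism of `ESCFM` is built from tower operations. -/

open PROP in
/-- The generators of `ESCFM` form an extraspecial commutative Frobenius monoid. -/
def ESCFM.extraSpecial : ESCFM.ExtraSpecial where
  mul := Quotient.mk _ (.gen .mul)
  unit := Quotient.mk _ (.gen .unit)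
  comul := Quotient.mk _ (.gen .comul)
  counit := Quotient.mk _ (.gen .counit)
  mul_assoc := Quotient.sound (.of .mul_assoc)
  mul_unit := Quotient.sound (.of .mul_unit)
  mul_comm := Quotient.sound (.of .mul_comm)
  comul_coassoc := Quotient.sound (.of .comul_coassoc)
  comul_counit := Quotient.sound (.of .comul_counit)
  comul_comm := Quotient.sound (.of .comul_comm)
  frobenius_left := Quotient.sound (.of .frobenius_left)
  frobenius_right := Quotient.sound (.of .frobenius_right)
  special := Quotient.sound (.of .special)
  extra := Quotient.sound (.of .extra)

open PROP in
theorem ESCFM.isGenerated {a b : ℕ} (f : ESCFM.Hom a b) :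
    ESCFM.extraSpecial.tower.IsGenerated f := by
  obtain ⟨t, rfl⟩ := Quotient.exists_rep f
  let K := ESCFM.extraSpecial
  induction t with
  | gen g =>
    cases g with
    | mul => exact K.isGenerated_of_left_zero (Tower.IsGenerated.m (X := K.tower) 0)
    | unit => exact K.isGenerated_of_left_zero (Tower.IsGenerated.u (X := K.tower) 0)
    | comul => exact K.isGenerated_of_left_zero (Tower.IsGenerated.d (X := K.tower) 0)
    | counit => exact K.isGenerated_of_left_zero (Tower.IsGenerated.e (X := K.tower) 0)
  | id n => exact .id n
  | comp _ _ ih ih' => exact Tower.IsGenerated.comp (X := K.tower) ih ih'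
  | tensor _ _ ih ih' => exact K.isGenerated_tensor ih ih'
  | swap m n => exact K.isGenerated_swap m n

/-! ### Bijective morphisms, quotients by kernels, and evaluation of presented PROPs. -/

namespace PROP

/-- A bijective morphism of PROPs is an isomorphism. -/
noncomputable def Iso.ofBijective {P : PROP.{u}} {Q : PROP.{v}} (F : Morphism P Q)
    (h : ∀ a b : ℕ, Function.Bijective (F.map (a := a) (b := b))) : Iso P Q :=
  let e (a b : ℕ) : P.Hom a b ≃ Q.Hom a b := Equiv.ofBijective _ (h a b)
  have he : ∀ {a b : ℕ} (g : Q.Hom a b), F.map ((e a b).symm g) = g := fun {a b} g =>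
    (e a b).apply_symm_apply g
  { hom := F
    inv :=
      { map := fun {a b} => (e a b).symm
        map_id := fun n => (h _ _).1 (by rw [he, F.map_id])
        map_comp := fun f g => (h _ _).1 (by rw [he, F.map_comp, he, he])
        map_tensor := fun f g => (h _ _).1 (by rw [he, F.map_tensor, he, he])
        map_swap := fun m n => (h _ _).1 (by rw [he, F.map_swap]) }
    hom_inv := fun {a b} f => (e a b).symm_apply_apply f
    inv_hom := he }

/-- The inverse of an isomorphism of PROPs. -/
def Iso.symm {P : PROP.{u}} {Q : PROP.{v}} (F : Iso P Q) : Iso Q P :=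
  ⟨F.inv, F.hom, F.inv_hom, F.hom_inv⟩

/-- The morphism that a morphism of PROPs induces on the quotient by its kernel. -/
def Morphism.ofKer {P : PROP.{u}} {Q : PROP.{v}} (F : Morphism P Q) :
    Morphism (P.quotient F.ker) Q where
  map := Quotient.lift F.map fun _ _ h => h
  map_id := F.map_id
  map_comp := by rintro a b c ⟨f⟩ ⟨g⟩; exact F.map_comp f g
  map_tensor := by rintro a b c d ⟨f⟩ ⟨g⟩; exact F.map_tensor f g
  map_swap := F.map_swap

theorem Morphism.ofKer_injective {P : PROP.{u}} {Q : PROP.{v}} (F : Morphism P Q) {a b : ℕ} :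
    Function.Injective (F.ofKer.map (a := a) (b := b)) := by
  rintro ⟨f⟩ ⟨g⟩ h
  exact Quotient.sound h

variable {G : ℕ → ℕ → Type} (Q : PROP.{u}) (φ : ∀ {a b : ℕ}, G a b → Q.Hom a b)

/-- The evaluation of terms in a PROP. -/
def Term.eval : ∀ {a b : ℕ}, Term G a b → Q.Hom a b
  | _, _, .gen g => φ g
  | _, _, .id n => Q.id n
  | _, _, .comp f g => Q.comp (eval f) (eval g)
  | _, _, .tensor f g => Q.tensor (eval f) (eval g)
  | _, _, .swap m n => Q.swap m n

theorem Term.eval_eqHom {a b : ℕ} (h : a = b) :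
    Term.eval Q φ ((termData G).eqHom h) = Q.eqHom h := by
  subst h; rfl

variable {E : ∀ a b : ℕ, Term G a b → Term G a b → Prop}

theorem TermRel.eval_eq (hE : ∀ {a b : ℕ} {s t : Term G a b}, E a b s t →
    s.eval Q φ = t.eval Q φ) {a b : ℕ} {s t : Term G a b} (h : TermRel E a b s t) :
    s.eval Q φ = t.eval Q φ := by
  induction h with
  | of h => exact hE h
  | refl s => rfl
  | symm _ ih => exact ih.symm
  | trans _ _ ih ih' => exact ih.trans ih'
  | comp _ _ ih ih' => rw [Term.eval, Term.eval, ih, ih']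
  | tensor _ _ ih ih' => rw [Term.eval, Term.eval, ih, ih']
  | id_comp f => exact Q.id_comp _
  | comp_id f => exact Q.comp_id _
  | assoc f g h => exact Q.assoc _ _ _
  | tensor_id m n => exact Q.tensor_id m n
  | interchange f g f' g' => exact Q.interchange _ _ _ _
  | tensor_assoc f g h =>
    simp only [Term.eval, Term.eval_eqHom]
    exact Q.tensor_assoc _ _ _
  | unit_tensor f =>
    simp only [Term.eval, Term.eval_eqHom]
    exact Q.unit_tensor _
  | tensor_unit f =>
    simp only [Term.eval, Term.eval_eqHom]
    exact Q.tensor_unit _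
  | swap_natural f g => exact Q.swap_natural _ _
  | swap_swap m n => exact Q.swap_swap m n
  | hexagon m n p =>
    simp only [Term.eval, Term.eval_eqHom]
    exact Q.hexagon m n p

/-- The morphism from a presented PROP given by the values of the generators. -/
def presentedLift (hE : ∀ {a b : ℕ} {s t : Term G a b}, E a b s t →
    s.eval Q φ = t.eval Q φ) : Morphism (presented E) Q where
  map := Quotient.lift (Term.eval Q φ) fun _ _ h => TermRel.eval_eq Q φ hE h
  map_id _ := rfl
  map_comp := by rintro a b c ⟨f⟩ ⟨g⟩; rfl
  map_tensor := by rintro a b c d ⟨f⟩ ⟨g⟩; rfl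
  map_swap _ _ := rfl

end PROP

/-! ### Corelations tested by truth-value labelings. -/

namespace FinCorelation

/-- A pair of labelings of inputs and outputs that is constant on the classes. -/
def Compatible {m n : ℕ} (R : FinCorelation m n) (x : Fin m → Prop) (y : Fin n → Prop) : Prop :=
  ∀ u v, R u v → Sum.elim x y u = Sum.elim x y v

/-- The indicator of the class of `u` is a compatible labeling, and it separates `u` from everything
outside its class. -/
theorem rel_iff {m n : ℕ} (R : FinCorelation m n) (u v : Fin m ⊕ Fin n) :
    R u v ↔ ∀ x y, R.Compatible x y → Sum.elim x y u = Sum.elim x y v := by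
  refine ⟨fun h x y hxy => hxy u v h, fun h => ?_⟩
  have h' := h (fun i => R u (.inl i)) (fun j => R u (.inr j)) (by
    intro v w hvw
    have : ∀ w, Sum.elim (fun i => R u (.inl i)) (fun j => R u (.inr j)) w = R u w := by
      rintro (w | w) <;> rfl
    rw [this, this]
    exact propext ⟨fun h => R.trans h hvw, fun h => R.trans h (R.symm hvw)⟩)
  have : ∀ w, Sum.elim (fun i => R u (.inl i)) (fun j => R u (.inr j)) w = R u w := by
    rintro (w | w) <;> rfl
  rw [this, this] at h'
  exact h' ▸ R.refl u

theorem ext_compatible {m n : ℕ} {R S : FinCorelation m n}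
    (h : ∀ x y, R.Compatible x y ↔ S.Compatible x y) : R = S := by
  refine Setoid.ext fun u v => ?_
  rw [R.rel_iff, S.rel_iff]
  exact forall₂_congr fun x y => by rw [h]

theorem compatible_graph {m n : ℕ} (s : Fin m → Fin n) (x : Fin m → Prop) (y : Fin n → Prop) :
    (graph s).Compatible x y ↔ x = y ∘ s := by
  constructor
  · intro h
    funext i
    exact h (.inl i) (.inr (s i)) rfl
  · rintro rfl u v h
    have : ∀ w, Sum.elim (y ∘ s) y w = y (Sum.elim s id w) := by rintro (w | w) <;> rfl
    rw [this, this]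
    exact congrArg y h

/-- The opposite of the graph of a map. -/
abbrev cograph {m n : ℕ} (s : Fin n → Fin m) : FinCorelation m n := Setoid.ker (Sum.elim id s)

theorem compatible_cograph {m n : ℕ} (s : Fin n → Fin m) (x : Fin m → Prop)
    (y : Fin n → Prop) : (cograph s).Compatible x y ↔ y = x ∘ s := by
  constructor
  · intro h
    funext i
    exact h (.inr i) (.inl (s i)) rfl
  · rintro rfl u v h
    have : ∀ w, Sum.elim x (x ∘ s) w = x (Sum.elim id s w) := by rintro (w | w) <;> rfl
    rw [this, this]
    exact congrArg x h

/-- A labeling of the outer boundary that is constant on the classes of the composite extends to the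
middle wires; conversely, labelings that agree on the middle are constant along chains in the
closure. -/
theorem compatible_comp {a b c : ℕ} (R : FinCorelation a b) (S : FinCorelation b c)
    (x : Fin a → Prop) (z : Fin c → Prop) :
    Compatible (data.comp R S) x z ↔ ∃ y, R.Compatible x y ∧ S.Compatible y z := by
  constructor
  · intro h
    -- A wire is labeled true when the closure joins it to a true boundary wire; classes that do not
    -- meet the boundary receive false.
    let w : Fin a ⊕ Fin b ⊕ Fin c → Prop := fun t =>
      ∃ u, closure R S t (Sum.map id Sum.inr u) ∧ Sum.elim x z u
    have hw : ∀ t t', closure R S t t' → w t = w t' := fun t t' htt' => propext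
      ⟨fun ⟨u, hu, hx⟩ => ⟨u, (closure R S).trans ((closure R S).symm htt') hu, hx⟩,
        fun ⟨u, hu, hx⟩ => ⟨u, (closure R S).trans htt' hu, hx⟩⟩
    have hw' : ∀ u, w (Sum.map id Sum.inr u) = Sum.elim x z u := fun u => propext
      ⟨fun ⟨v, hv, hx⟩ => (h u v hv).symm ▸ hx, fun hu => ⟨u, (closure R S).refl _, hu⟩⟩
    refine ⟨fun j => w (.inr (.inl j)), ?_, ?_⟩
    · intro u v huv
      have : ∀ t, Sum.elim x (fun j => w (.inr (.inl j))) t = w (Sum.map id Sum.inl t) := by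
        rintro (t | t)
        · exact (hw' (.inl t)).symm
        · rfl
      rw [this, this]
      exact hw _ _ (.single (.left huv))
    · intro u v huv
      have : ∀ t, Sum.elim (fun j => w (.inr (.inl j))) z t = w (Sum.inr t) := by
        rintro (t | t)
        · rfl
        · exact (hw' (.inr t)).symm
      rw [this, this]
      exact hw _ _ (.single (.right huv))
  · rintro ⟨y, hR, hS⟩ u v huv
    have key : ∀ t t', closure R S t t' →
        Sum.elim x (Sum.elim y z) t = Sum.elim x (Sum.elim y z) t' := by
      have step : ∀ t t', Union R S t t' →
          Sum.elim x (Sum.elim y z) t = Sum.elim x (Sum.elim y z) t' := by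
        rintro _ _ (@⟨u, v, h⟩ | @⟨u, v, h⟩)
        · have := hR u v h
          rcases u with u | u <;> rcases v with v | v <;> exact this
        · exact hS u v h
      intro t t' h
      induction h with
      | single h => exact step _ _ h
      | tail _ h ih => exact ih.trans (step _ _ h)
    have := key _ _ huv
    rcases u with u | u <;> rcases v with v | v <;> exact this

theorem compatible_tensor {a b c d : ℕ} (R : FinCorelation a b) (S : FinCorelation c d)
    (x : Fin (a + c) → Prop) (y : Fin (b + d) → Prop) :
    Compatible (data.tensor R S) x y ↔
      R.Compatible (x ∘ Fin.castAdd c) (y ∘ Fin.castAdd d) ∧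
        S.Compatible (x ∘ Fin.natAdd a) (y ∘ Fin.natAdd b) := by
  have key : ∀ t, Sum.elim x y t = Sum.elim
      (Sum.elim (x ∘ Fin.castAdd c) (y ∘ Fin.castAdd d))
      (Sum.elim (x ∘ Fin.natAdd a) (y ∘ Fin.natAdd b)) (split a b c d t) := by
    rintro (t | t) <;> obtain ⟨t | t, rfl⟩ := finSumFinEquiv.surjective t
    all_goals simp [split, Equiv.sumSumSumComm]
  constructor
  · intro h
    constructor
    · intro u v huv
      have := h ((split a b c d).symm (.inl u)) ((split a b c d).symm (.inl v)) (by
        change Sum.LiftRel _ _ _ _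
        rw [Equiv.apply_symm_apply, Equiv.apply_symm_apply]
        exact .inl huv)
      rw [key, key, Equiv.apply_symm_apply, Equiv.apply_symm_apply] at this
      exact this
    · intro u v huv
      have := h ((split a b c d).symm (.inr u)) ((split a b c d).symm (.inr v)) (by
        change Sum.LiftRel _ _ _ _
        rw [Equiv.apply_symm_apply, Equiv.apply_symm_apply]
        exact .inr huv)
      rw [key, key, Equiv.apply_symm_apply, Equiv.apply_symm_apply] at this
      exact this
  · rintro ⟨hR, hS⟩ u v huv
    change Sum.LiftRel _ _ _ _ at huv
    rw [key, key]
    revert huv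
    generalize split a b c d u = u
    generalize split a b c d v = v
    rintro (h | h)
    · exact hR _ _ h
    · exact hS _ _ h

end FinCorelation

/-! ### Relational semantics of towers, and its faithfulness on normal forms. -/

namespace Tower

/-- An interpretation of a tower in relations between truth values on the wires. -/
structure Semantics (X : Tower) where
  Rel : ∀ {a b : ℕ}, X.Hom a b → (Fin a → Prop) → (Fin b → Prop) → Prop
  rel_id : ∀ (n : ℕ) (x y : Fin n → Prop), Rel (X.id n) x y ↔ x = y
  rel_comp : ∀ {a b c : ℕ} (f : X.Hom a b) (g : X.Hom b c) (x : Fin a → Prop)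
    (z : Fin c → Prop), Rel (X.comp f g) x z ↔ ∃ y, Rel f x y ∧ Rel g y z
  rel_T : ∀ {a b : ℕ} (f : X.Hom a b) (x : Fin (a + 1) → Prop) (y : Fin (b + 1) → Prop),
    Rel (X.T f) x y ↔
      Rel f (x ∘ Fin.castSucc) (y ∘ Fin.castSucc) ∧ x (Fin.last a) = y (Fin.last b)
  rel_m : ∀ (n : ℕ) (x : Fin (n + 1 + 1) → Prop) (y : Fin (n + 1) → Prop),
    Rel (X.m n) x y ↔ y = x ∘ Fin.castSucc ∧ x (Fin.last (n + 1)) = y (Fin.last n)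
  rel_u : ∀ (n : ℕ) (x : Fin n → Prop) (y : Fin (n + 1) → Prop),
    Rel (X.u n) x y ↔ x = y ∘ Fin.castSucc
  rel_d : ∀ (n : ℕ) (x : Fin (n + 1) → Prop) (y : Fin (n + 1 + 1) → Prop),
    Rel (X.d n) x y ↔ x = y ∘ Fin.castSucc ∧ y (Fin.last (n + 1)) = x (Fin.last n)
  rel_e : ∀ (n : ℕ) (x : Fin (n + 1) → Prop) (y : Fin n → Prop),
    Rel (X.e n) x y ↔ y = x ∘ Fin.castSucc
  rel_s : ∀ (n : ℕ) (x y : Fin (n + 1 + 1) → Prop), Rel (X.s n) x y ↔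
    x ∘ Fin.castSucc ∘ Fin.castSucc = y ∘ Fin.castSucc ∘ Fin.castSucc ∧
      x (Fin.last n).castSucc = y (Fin.last (n + 1)) ∧
      x (Fin.last (n + 1)) = y (Fin.last n).castSucc

namespace Semantics

variable {X : Tower} (S : X.Semantics)

theorem rel_act {n : ℕ} (j : Fin n) (x : Fin (n + 1) → Prop) (y : Fin n → Prop) :
    S.Rel (X.act j) x y ↔ y = x ∘ Fin.castSucc ∧ x (Fin.last n) = y j := by
  induction n with
  | zero => exact j.elim0
  | succ n ih =>
    induction j using Fin.lastCases with
    | last => rw [act_last, S.rel_m]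
    | cast j =>
      rw [act_castSucc, S.rel_comp]
      simp only [S.rel_s, S.rel_T, ih]
      constructor
      · rintro ⟨z, ⟨h₁, h₂, h₃⟩, ⟨h₄, h₅⟩, h₆⟩
        refine ⟨funext fun i => ?_, h₃.trans h₅⟩
        induction i using Fin.lastCases with
        | last => exact h₆.symm.trans h₂.symm
        | cast i => exact (congrFun h₄ i).trans (congrFun h₁ i).symm
      · rintro ⟨rfl, h⟩
        -- The intermediate labeling is `x` with its last two values exchanged by the crossing.
        refine ⟨Fin.snoc (α := fun _ => Prop) (Fin.snoc (α := fun _ => Prop)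
          (x ∘ Fin.castSucc ∘ Fin.castSucc) (x (Fin.last (n + 1)))) (x (Fin.last n).castSucc),
          ?_⟩
        refine ⟨⟨?_, ?_, ?_⟩, ⟨?_, ?_⟩, ?_⟩
        · funext i; simp
        · simp
        · simp
        · funext i; simp
        · simpa using h
        · simp

theorem rel_coact {n : ℕ} (j : Fin n) (x : Fin n → Prop) (y : Fin (n + 1) → Prop) :
    S.Rel (X.coact j) x y ↔ x = y ∘ Fin.castSucc ∧ y (Fin.last n) = x j := by
  induction n with
  | zero => exact j.elim0
  | succ n ih =>
    induction j using Fin.lastCases with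
    | last => rw [coact_last, S.rel_d]
    | cast j =>
      rw [coact_castSucc, S.rel_comp]
      simp only [S.rel_s, S.rel_T, ih]
      constructor
      · rintro ⟨z, ⟨⟨h₄, h₅⟩, h₆⟩, h₁, h₂, h₃⟩
        refine ⟨funext fun i => ?_, h₂.symm.trans h₅⟩
        induction i using Fin.lastCases with
        | last => exact h₆.trans h₃
        | cast i => exact (congrFun h₄ i).trans (congrFun h₁ i)
      · rintro ⟨rfl, h⟩
        refine ⟨Fin.snoc (α := fun _ => Prop) (Fin.snoc (α := fun _ => Prop)
          (y ∘ Fin.castSucc ∘ Fin.castSucc) (y (Fin.last (n + 1)))) (y (Fin.last n).castSucc),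
          ?_⟩
        refine ⟨⟨⟨?_, ?_⟩, ?_⟩, ?_, ?_, ?_⟩
        · funext i; simp
        · simpa using h
        · simp
        · funext i; simp
        · simp
        · simp

theorem rel_link {n : ℕ} (i j : Fin n) (x y : Fin n → Prop) :
    S.Rel (X.link i j) x y ↔ x = y ∧ x i = x j := by
  rw [link, S.rel_comp]
  constructor
  · rintro ⟨z, h, h'⟩
    rw [S.rel_coact] at h
    rw [S.rel_act] at h'
    obtain ⟨rfl, h⟩ := h
    obtain ⟨rfl, h'⟩ := h'
    exact ⟨rfl, h.symm.trans h'⟩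
  · rintro ⟨rfl, h⟩
    refine ⟨Fin.snoc (α := fun _ => Prop) x (x i), ?_, ?_⟩
    · rw [S.rel_coact, Fin.snoc_last]
      exact ⟨(Fin.snoc_comp_castSucc ..).symm, rfl⟩
    · rw [S.rel_act, Fin.snoc_last]
      exact ⟨(Fin.snoc_comp_castSucc ..).symm, h⟩

theorem rel_links {n : ℕ} (l : List (Fin n × Fin n)) (x y : Fin n → Prop) :
    S.Rel (X.links l) x y ↔ x = y ∧ ∀ p ∈ l, x p.1 = x p.2 := by
  induction l generalizing x with
  | nil => exact (S.rel_id n x y).trans (by simp)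
  | cons p l ih =>
    rw [links, S.rel_comp]
    simp only [S.rel_link, ih, List.forall_mem_cons]
    constructor
    · rintro ⟨z, ⟨rfl, h⟩, rfl, h'⟩
      exact ⟨rfl, h, h'⟩
    · rintro ⟨rfl, h, h'⟩
      exact ⟨x, ⟨rfl, h⟩, rfl, h'⟩

theorem rel_units (m k : ℕ) (x : Fin m → Prop) (y : Fin (m + k) → Prop) :
    S.Rel (X.units m k) x y ↔ x = y ∘ Fin.castAdd k := by
  induction k with
  | zero => exact S.rel_id m x y
  | succ k ih =>
    rw [units, S.rel_comp]
    simp only [S.rel_u, ih]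
    constructor
    · rintro ⟨z, rfl, rfl⟩
      rfl
    · rintro rfl
      exact ⟨_, rfl, rfl⟩

theorem rel_discardAll (m : ℕ) (x : Fin m → Prop) (y : Fin 0 → Prop) :
    S.Rel (X.discardAll m) x y := by
  induction m with
  | zero => exact (S.rel_id 0 x y).2 (funext fun i => i.elim0)
  | succ m ih => exact (S.rel_comp _ _ x y).2 ⟨_, (S.rel_e m x _).2 rfl, ih _⟩

theorem rel_discard (m n : ℕ) (x : Fin (m + n) → Prop) (y : Fin n → Prop) :
    S.Rel (X.discard m n) x y ↔ y = x ∘ Fin.natAdd m := by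
  induction n with
  | zero =>
    exact iff_of_true (S.rel_discardAll m x y) (funext fun i => i.elim0)
  | succ n ih =>
    refine (S.rel_T _ x y).trans ?_
    rw [ih, funext_iff, funext_iff, Fin.forall_fin_succ', eq_comm (a := x _)]
    rfl

theorem rel_normal (m n : ℕ) (l : List (Fin (m + n) × Fin (m + n)))
    (x : Fin m → Prop) (y : Fin n → Prop) :
    S.Rel (X.normal m n l) x y ↔
      ∃ z : Fin (m + n) → Prop, x = z ∘ Fin.castAdd n ∧ y = z ∘ Fin.natAdd m ∧
        ∀ p ∈ l, z p.1 = z p.2 := by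
  rw [normal, S.rel_comp]
  simp only [S.rel_comp, S.rel_units, S.rel_links, S.rel_discard]
  constructor
  · rintro ⟨z, h, _, ⟨rfl, hl⟩, h'⟩
    exact ⟨z, h, h', hl⟩
  · rintro ⟨z, h, h', hl⟩
    exact ⟨z, h, z, ⟨rfl, hl⟩, h'⟩

/-- The test labeling is the indicator of the class of `p.1` under `l`. It respects `l`, hence `l'`,
so it takes the same value at `p.2` as at `p.1`. Labels on inputs and outputs determine it, because
these are all the wires. -/
theorem connected_of_rel {m n : ℕ} {l l' : List (Fin (m + n) × Fin (m + n))}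
    (h : ∀ x y, S.Rel (X.normal m n l) x y → S.Rel (X.normal m n l') x y) :
    ∀ p ∈ l', Connected l p.1 p.2 := by
  intro p hp
  let z : Fin (m + n) → Prop := Connected l p.1
  obtain ⟨z', h₁, h₂, hz'⟩ := (S.rel_normal _ _ _ _ _).1 (h (z ∘ Fin.castAdd n)
    (z ∘ Fin.natAdd m) ((S.rel_normal _ _ _ _ _).2 ⟨z, rfl, rfl, fun q hq => propext
      ⟨fun hq' => hq'.trans _ _ _ (.rel _ _ hq),
        fun hq' => hq'.trans _ _ _ (Relation.EqvGen.rel _ _ hq).symm⟩⟩))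
  have : z = z' := funext fun i => Fin.addCases (congrFun h₁) (congrFun h₂) i
  subst this
  have : z p.1 = z p.2 := hz' p hp
  exact this.mp (Relation.EqvGen.refl p.1)

/-- Normal forms with the same labelings have lists that generate the same equivalence relation, so
`links_eq` applies. -/
theorem eq_of_rel {m n : ℕ} {f g : X.Hom m n} (hf : X.IsGenerated f) (hg : X.IsGenerated g)
    (h : ∀ x y, S.Rel f x y ↔ S.Rel g x y) : f = g := by
  obtain ⟨l, rfl⟩ := hf.exists_normal
  obtain ⟨l', rfl⟩ := hg.exists_normal
  rw [normal, normal, X.links_eq (S.connected_of_rel fun x y => (h x y).1)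
    (S.connected_of_rel fun x y => (h x y).2)]

end Semantics

end Tower

/-! ### The interpretation of `ESCFM` in corelations and its bijectivity. -/

section Interpretation

open FinCorelation

/-- The corelations of the generators. -/
def FrobGen.corelation : ∀ {a b : ℕ}, FrobGen a b → FinCorel.Hom a b
  | _, _, .mul => graph fun _ : Fin 2 => (0 : Fin 1)
  | _, _, .unit => graph fun i : Fin 0 => (i.elim0 : Fin 1)
  | _, _, .comul => cograph fun _ : Fin 2 => (0 : Fin 1)
  | _, _, .counit => cograph fun i : Fin 0 => (i.elim0 : Fin 1)

namespace PROP.Term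

/-- The labelings that are compatible with the corelation of a term. -/
def Compatible {a b : ℕ} (t : Term FrobGen a b) (x : Fin a → Prop) (y : Fin b → Prop) : Prop :=
  FinCorelation.Compatible (t.eval FinCorel FrobGen.corelation) x y

theorem compatible_id (n : ℕ) (x y : Fin n → Prop) :
    (Term.id n : Term FrobGen n n).Compatible x y ↔ x = y :=
  compatible_graph _root_.id x y

theorem compatible_comp {a b c : ℕ} (s : Term FrobGen a b) (t : Term FrobGen b c)
    (x : Fin a → Prop) (z : Fin c → Prop) :
    (Term.comp s t).Compatible x z ↔ ∃ y, s.Compatible x y ∧ t.Compatible y z :=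
  FinCorelation.compatible_comp _ _ x z

theorem compatible_tensor {a b c d : ℕ} (s : Term FrobGen a b) (t : Term FrobGen c d)
    (x : Fin (a + c) → Prop) (y : Fin (b + d) → Prop) :
    (Term.tensor s t).Compatible x y ↔
      s.Compatible (x ∘ Fin.castAdd c) (y ∘ Fin.castAdd d) ∧
        t.Compatible (x ∘ Fin.natAdd a) (y ∘ Fin.natAdd b) :=
  FinCorelation.compatible_tensor _ _ x y

theorem compatible_swap (m n : ℕ) (x : Fin (m + n) → Prop) (y : Fin (n + m) → Prop) :
    (Term.swap m n : Term FrobGen _ _).Compatible x y ↔ x = y ∘ finAddFlip :=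
  compatible_graph _ x y

theorem compatible_mul (x : Fin 2 → Prop) (y : Fin 1 → Prop) :
    FrobGen.μ.Compatible x y ↔ x 0 = y 0 ∧ x 1 = y 0 := by
  refine (compatible_graph (fun _ : Fin 2 => (0 : Fin 1)) x y).trans ?_
  simp [funext_iff, Fin.forall_fin_succ]

theorem compatible_comul (x : Fin 1 → Prop) (y : Fin 2 → Prop) :
    FrobGen.δ.Compatible x y ↔ y 0 = x 0 ∧ y 1 = x 0 := by
  refine (compatible_cograph (fun _ : Fin 2 => (0 : Fin 1)) x y).trans ?_
  simp [funext_iff, Fin.forall_fin_succ]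

theorem compatible_unit (x : Fin 0 → Prop) (y : Fin 1 → Prop) : FrobGen.η.Compatible x y :=
  (compatible_graph (fun i : Fin 0 => (i.elim0 : Fin 1)) x y).2 (funext fun i => i.elim0)

theorem compatible_counit (x : Fin 1 → Prop) (y : Fin 0 → Prop) : FrobGen.ε.Compatible x y :=
  (compatible_cograph (fun i : Fin 0 => (i.elim0 : Fin 1)) x y).2 (funext fun i => i.elim0)

end PROP.Term

-- Through compatible labelings each equation becomes an equivalence of propositional formulas in
-- the labels of finitely many wires.
open PROP.Term in
theorem ESCFMEq.eval_eq {a b : ℕ} {s t : PROP.Term FrobGen a b} (h : ESCFMEq a b s t) :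
    s.eval FinCorel FrobGen.corelation = t.eval FinCorel FrobGen.corelation := by
  refine ext_compatible fun x y => ?_
  change s.Compatible x y ↔ t.Compatible x y
  have flip_zero : (finAddFlip (0 : Fin (1 + 1)) : Fin (1 + 1)) = 1 := rfl
  have flip_one : (finAddFlip (1 : Fin (1 + 1)) : Fin (1 + 1)) = 0 := rfl
  have cons_two : ∀ (p q r : Prop) (z : Fin 0 → Prop),
      (Fin.cons p (Fin.cons q (Fin.cons r z : Fin 1 → Prop) : Fin 2 → Prop) : Fin 3 → Prop) 2 =
        r := fun _ _ _ _ => rfl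
  cases h <;>
    simp only [compatible_id, PROP.Term.compatible_comp, PROP.Term.compatible_tensor,
      compatible_mul, compatible_comul, compatible_unit, compatible_counit, compatible_swap,
      funext_iff, Fin.forall_fin_succ, Fin.exists_fin_succ_pi]
  -- The labels of inner wires are quantified over `Prop`; replacing each by its two truth values
  -- leaves propositional tautologies.
  all_goals simp [Prop.exists_iff, flip_zero, flip_one, cons_two]
  all_goals tauto

open PROP in
/-- The interpretation of `ESCFM` in corelations. -/
def ESCFM.toFinCorel : Morphism ESCFM FinCorel :=
  presentedLift FinCorel FrobGen.corelation ESCFMEq.eval_eq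

namespace ESCFM

/-- The labelings that are compatible with the corelation of a morphism of `ESCFM`. -/
def Compatible {a b : ℕ} (f : ESCFM.Hom a b) (x : Fin a → Prop) (y : Fin b → Prop) : Prop :=
  FinCorelation.Compatible (toFinCorel.map f) x y

theorem compatible_id (n : ℕ) (x y : Fin n → Prop) :
    Compatible (ESCFM.id n) x y ↔ x = y :=
  compatible_graph _root_.id x y

theorem compatible_comp {a b c : ℕ} (f : ESCFM.Hom a b) (g : ESCFM.Hom b c)
    (x : Fin a → Prop) (z : Fin c → Prop) :
    Compatible (ESCFM.comp f g) x z ↔ ∃ y, Compatible f x y ∧ Compatible g y z := by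
  exact (iff_of_eq (congrArg (fun R => FinCorelation.Compatible R x z)
    (toFinCorel.map_comp f g))).trans (FinCorelation.compatible_comp _ _ x z)

theorem compatible_tensor {a b c d : ℕ} (f : ESCFM.Hom a b) (g : ESCFM.Hom c d)
    (x : Fin (a + c) → Prop) (y : Fin (b + d) → Prop) :
    Compatible (ESCFM.tensor f g) x y ↔
      Compatible f (x ∘ Fin.castAdd c) (y ∘ Fin.castAdd d) ∧
        Compatible g (x ∘ Fin.natAdd a) (y ∘ Fin.natAdd b) := by
  exact (iff_of_eq (congrArg (fun R => FinCorelation.Compatible R x y)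
    (toFinCorel.map_tensor f g))).trans (FinCorelation.compatible_tensor _ _ x y)

theorem compatible_T {a b : ℕ} (f : ESCFM.Hom a b) (x : Fin (a + 1) → Prop)
    (y : Fin (b + 1) → Prop) : Compatible (ESCFM.right f) x y ↔
      Compatible f (x ∘ Fin.castSucc) (y ∘ Fin.castSucc) ∧ x (Fin.last a) = y (Fin.last b) := by
  refine (compatible_tensor f (ESCFM.id 1) x y).trans (and_congr_right fun _ =>
    (compatible_id 1 _ _).trans ?_)
  rw [funext_iff, Fin.forall_fin_one]
  rfl

theorem compatible_left (n : ℕ) {a b : ℕ} (f : ESCFM.Hom a b) (x : Fin (n + a) → Prop)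
    (y : Fin (n + b) → Prop) : Compatible (ESCFM.left n f) x y ↔
      x ∘ Fin.castAdd a = y ∘ Fin.castAdd b ∧
        Compatible f (x ∘ Fin.natAdd n) (y ∘ Fin.natAdd n) :=
  (compatible_tensor (ESCFM.id n) f x y).trans (and_congr_left fun _ => compatible_id n _ _)

theorem compatible_mul (x : Fin 2 → Prop) (y : Fin 1 → Prop) :
    Compatible extraSpecial.mul x y ↔ x 0 = y 0 ∧ x 1 = y 0 :=
  PROP.Term.compatible_mul x y

theorem compatible_comul (x : Fin 1 → Prop) (y : Fin 2 → Prop) :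
    Compatible extraSpecial.comul x y ↔ y 0 = x 0 ∧ y 1 = x 0 :=
  PROP.Term.compatible_comul x y

theorem compatible_unit (x : Fin 0 → Prop) (y : Fin 1 → Prop) :
    Compatible extraSpecial.unit x y :=
  PROP.Term.compatible_unit x y

theorem compatible_counit (x : Fin 1 → Prop) (y : Fin 0 → Prop) :
    Compatible extraSpecial.counit x y :=
  PROP.Term.compatible_counit x y

theorem compatible_swap_one_one (x y : Fin 2 → Prop) :
    Compatible (ESCFM.swap 1 1) x y ↔ x = y ∘ finAddFlip (m := 1) (n := 1) :=
  PROP.Term.compatible_swap 1 1 x y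

theorem compatible_m (n : ℕ) (x : Fin (n + 1 + 1) → Prop) (y : Fin (n + 1) → Prop) :
    Compatible (ESCFM.left n extraSpecial.mul) x y ↔
      y = x ∘ Fin.castSucc ∧ x (Fin.last (n + 1)) = y (Fin.last n) := by
  refine (compatible_left n extraSpecial.mul x y).trans ((and_congr_right fun _ =>
    compatible_mul _ _).trans ?_)
  rw [funext_iff, funext_iff, Fin.forall_fin_succ']
  change (∀ i : Fin n, x i.castSucc.castSucc = y i.castSucc) ∧
    x (Fin.last n).castSucc = y (Fin.last n) ∧ x (Fin.last (n + 1)) = y (Fin.last n) ↔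
    ((∀ i : Fin n, y i.castSucc = x i.castSucc.castSucc) ∧
      y (Fin.last n) = x (Fin.last n).castSucc) ∧ x (Fin.last (n + 1)) = y (Fin.last n)
  simp only [eq_comm, and_assoc]

theorem compatible_d (n : ℕ) (x : Fin (n + 1) → Prop) (y : Fin (n + 1 + 1) → Prop) :
    Compatible (ESCFM.left n extraSpecial.comul) x y ↔
      x = y ∘ Fin.castSucc ∧ y (Fin.last (n + 1)) = x (Fin.last n) := by
  refine (compatible_left n extraSpecial.comul x y).trans ((and_congr_right fun _ =>
    compatible_comul _ _).trans ?_)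
  rw [funext_iff, funext_iff, Fin.forall_fin_succ']
  change (∀ i : Fin n, x i.castSucc = y i.castSucc.castSucc) ∧
    y (Fin.last n).castSucc = x (Fin.last n) ∧ y (Fin.last (n + 1)) = x (Fin.last n) ↔
    ((∀ i : Fin n, x i.castSucc = y i.castSucc.castSucc) ∧
      x (Fin.last n) = y (Fin.last n).castSucc) ∧ y (Fin.last (n + 1)) = x (Fin.last n)
  rw [eq_comm (a := x (Fin.last n)), and_assoc]

theorem compatible_u (n : ℕ) (x : Fin n → Prop) (y : Fin (n + 1) → Prop) :
    Compatible (ESCFM.left n extraSpecial.unit) x y ↔ x = y ∘ Fin.castSucc :=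
  (compatible_left n extraSpecial.unit x y).trans (and_iff_left (compatible_unit _ _))

theorem compatible_e (n : ℕ) (x : Fin (n + 1) → Prop) (y : Fin n → Prop) :
    Compatible (ESCFM.left n extraSpecial.counit) x y ↔ y = x ∘ Fin.castSucc :=
  ((compatible_left n extraSpecial.counit x y).trans (and_iff_left (compatible_counit _ _))).trans
    eq_comm

theorem compatible_s (n : ℕ) (x y : Fin (n + 1 + 1) → Prop) :
    Compatible (ESCFM.left n (ESCFM.swap 1 1)) x y ↔
      x ∘ Fin.castSucc ∘ Fin.castSucc = y ∘ Fin.castSucc ∘ Fin.castSucc ∧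
        x (Fin.last n).castSucc = y (Fin.last (n + 1)) ∧
        x (Fin.last (n + 1)) = y (Fin.last n).castSucc := by
  refine (compatible_left n (ESCFM.swap 1 1) x y).trans (and_congr_right fun _ =>
    (compatible_swap_one_one _ _).trans ?_)
  rw [funext_iff, Fin.forall_fin_two]
  rfl

/-- The semantics of `ESCFM` given by the labelings that are compatible with corelations. -/
def semantics : extraSpecial.tower.Semantics where
  Rel f := Compatible f
  rel_id := compatible_id
  rel_comp := compatible_comp
  rel_T := compatible_T
  rel_m := compatible_m
  rel_u := compatible_u
  rel_d := compatible_d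
  rel_e := compatible_e
  rel_s := compatible_s

theorem toFinCorel_injective (m n : ℕ) :
    Function.Injective (toFinCorel.map (a := m) (b := n)) := fun f g h =>
  semantics.eq_of_rel (isGenerated f) (isGenerated g) fun x y =>
    iff_of_eq (congrArg (fun R => FinCorelation.Compatible R x y) h)

/-- By `rel_normal`, linking exactly the pairs of `R` imposes on the labels precisely that they be
constant on the classes of `R`. -/
theorem toFinCorel_surjective (m n : ℕ) :
    Function.Surjective (toFinCorel.map (a := m) (b := n)) := by
  classical
  intro (R : FinCorelation m n)
  let l := ((Finset.univ.filter fun p : (Fin m ⊕ Fin n) × (Fin m ⊕ Fin n) =>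
    R p.1 p.2).toList).map (Prod.map finSumFinEquiv finSumFinEquiv)
  refine ⟨extraSpecial.tower.normal m n l, ext_compatible fun x y => ?_⟩
  refine (semantics.rel_normal m n l x y).trans ?_
  have hl : ∀ z : Fin (m + n) → Prop, (∀ p ∈ l, z p.1 = z p.2) ↔
      ∀ u v, R u v → z (finSumFinEquiv u) = z (finSumFinEquiv v) := by
    intro z
    simp only [l, List.forall_mem_map, Finset.mem_toList, Finset.mem_filter, Finset.mem_univ,
      true_and, Prod.forall, Prod.map]
  simp only [hl]
  constructor
  · rintro ⟨z, rfl, rfl, hz⟩ u v huv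
    have : ∀ w, Sum.elim (z ∘ Fin.castAdd n) (z ∘ Fin.natAdd m) w = z (finSumFinEquiv w) := by
      rintro (w | w) <;> rfl
    rw [this, this]
    exact hz u v huv
  · intro h
    refine ⟨Sum.elim x y ∘ finSumFinEquiv.symm, ?_, ?_, fun u v huv => ?_⟩
    · funext i; simp
    · funext i; simp
    · simpa using h u v huv

end ESCFM

end Interpretation

/-! ### The two isomorphisms of PROPs. -/

theorem mainTheorem3 :
    (∃ Pi : PROP.Morphism CospanFinSet FinCorel,
      (∀ (m n : ℕ) (c : FinCospan m n),
        Pi.map (Quotient.mk (FinCospan.setoid m n) c) = c.ker) ∧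
      ∃ Phi : PROP.Iso (CospanFinSet.quotient Pi.ker) FinCorel,
        ∀ (m n : ℕ) (f : CospanFinSet.Hom m n),
          Phi.hom.map ((CospanFinSet.proj Pi.ker).map f) = Pi.map f) ∧
    Nonempty (PROP.Iso FinCorel ESCFM) := by
  refine ⟨⟨⟨FinCospan.kerClass, FinCospan.kerClass_id, FinCospan.kerClass_comp,
    FinCospan.kerClass_tensor, FinCospan.kerClass_swap⟩, fun _ _ _ => rfl, ?_⟩, ?_⟩
  · refine ⟨.ofBijective (PROP.Morphism.ofKer _) fun m n =>
      ⟨PROP.Morphism.ofKer_injective _, fun R => ?_⟩, fun _ _ _ => rfl⟩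
    obtain ⟨c, hc⟩ := FinCospan.kerClass_surjective m n R
    exact ⟨Quotient.mk _ c, hc⟩
  · exact ⟨(PROP.Iso.ofBijective ESCFM.toFinCorel fun m n =>
      ⟨ESCFM.toFinCorel_injective m n, ESCFM.toFinCorel_surjective m n⟩).symm⟩
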